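/- Let $p,q\in\mathbb{N}$, $n=p+q$. A $(p,q)$-clan is an involution $\gamma$ of $[n]=\{1,\dots,n\}$ (the identity is allowed) whose fixed points are each labelled $+$ or $-$, with (number of $+$) $-$ (number of $-$) $=p-q$. Write $\mathrm{Clan}_{p,q}$ for the set of these, $s_i=(i\;\,i{+}1)$ for $1\le i<n$, and $\ell$ for the number of inversions of a permutation. Define $\gamma * s_i$ as follows: if $i,i+1$ are fixed points of opposite sign, they become matched to each other, all else being unchanged; if $i,i+1$ are fixed points of equal sign, or are matched to each other, $\gamma * s_i$ is undefined; in all other cases $\gamma * s_i=s_i\gamma s_i$, with the signs carried along by $s_i$. The weak order on $\mathrm{Clan}_{p,q}$ is the transitive closure of $\gamma * s_i<\gamma$ whenever $\gamma*s_i$ is defined and the underlying involution of $\gamma * s_i$ has larger length $\ell$ than that of $\gamma$. Let $\gamma_{p,q}$ be the clan with underlying involution $(1\;\,n)(2\;\,n{-}1)\cdots(m\;\,n{-}m{+}1)$, $m=\min(p,q)$, whose fixed points all have the sign of $p-q$. A word $a_1\cdots a_\ell$ is a reduced word for $\gamma$ if there is a saturated chain in weak order from $\gamma_{p,q}$ to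 $\gamma$ whose successive covering relations $\gamma' * s_{a_j}\lessdot\gamma'$ have labels $s_{a_1},\dots,s_{a_\ell}$ in this order. The set $\mathcal{A}(\gamma)\subseteq S_n$ of atoms of $\gamma$ is the set of permutations such that the set of reduced words of $\gamma$ is the union of the sets of reduced words of the $w\in\mathcal{A}(\gamma)$; equivalently, $w \in \mathcal{A}(\gamma)$ iff every reduced word of $w$ is a reduced word of $\gamma$. For permutations $v,w\in S_n$ that are atoms for some members of $\mathrm{Clan}_{p,q}$, write $v\sim w$ if $v$ and $w$ are atoms of exactly the same $(p,q)$-clans. For such a $w$ let the unlabelled shape $\operatorname{ush}(w)$ be the partial matching of $[n]$ with arcs $\{w^{-1}(k),w^{-1}(n{-}k{+}1)\}$, $1\le k\le\min(p,q)$, where this arc is marked if $w^{-1}(k)>w^{-1}(n{-}k{+}1)$ and unmarked otherwise; as data, it is the set of arcs together with the set of endpoints of marked arcs. Theorem. (1) If $u$ is an atom for some member of $\mathrm{Clan}_{p,q}$, $1\le k<\min(p,q)$ and $\ell(s_ks_{n-k}u)=\ell(u)$, then $s_ks_{n-k}u$ is also an atom for some member of $\mathrm{Clan}_{p,q}$.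 (2) The equivalence relation $\sim$ on the set of atoms for members of $\mathrm{Clan}_{p,q}$ is the reflexive-transitive closure of the (symmetric) relation relating $u$ to $s_ks_{n-k}u$ whenever $1\le k<\min(p,q)$ and $\ell(s_ks_{n-k}u)=\ell(u)$. (3) For atoms $v,w$ for members of $\mathrm{Clan}_{p,q}$, $v\sim w$ if and only if $\operatorname{ush}(v)=\operatorname{ush}(w)$. -/

import Mathlib

/-! Positions and values are written `1, ..., n` in the comments; the element `k` of `[n]` is
the element of `Fin n` whose underlying natural number is `k - 1`. -/

/-- The adjacent transposition `s_k = (k k+1)` of `S_n`, for `1 ≤ k < n`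
(the identity for all other `k`, which are never used). -/
def adjSwap (n k : ℕ) : Equiv.Perm (Fin n) :=
  if h : 1 ≤ k ∧ k < n then
    Equiv.swap (⟨k - 1, by omega⟩ : Fin n) (⟨k, h.2⟩ : Fin n)
  else 1

/-- The Coxeter length of a permutation: its number of inversions. -/
def permLength {n : ℕ} (w : Equiv.Perm (Fin n)) : ℕ :=
  (Finset.univ.filter (fun x : Fin n × Fin n => x.1 < x.2 ∧ w x.2 < w x.1)).card

/-- Words in the alphabet `{1, ..., n-1}`. -/
def IsWord (n : ℕ) (a : List ℕ) : Prop := ∀ k ∈ a, 1 ≤ k ∧ k < n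

/-- The product `s_{a_1} s_{a_2} ⋯ s_{a_ℓ}`. -/
def wordProd (n : ℕ) (a : List ℕ) : Equiv.Perm (Fin n) := (a.map (adjSwap n)).prod

/-- The set `R(w)` of reduced words of a permutation: the words of minimal length with product `w`. -/
def permReducedWords {n : ℕ} (w : Equiv.Perm (Fin n)) : Set (List ℕ) :=
  {a | IsWord n a ∧ wordProd n a = w ∧
    ∀ b : List ℕ, IsWord n b → wordProd n b = w → a.length ≤ b.length}

/-- A `(p,q)`-clan: an involution in `S_{p+q}` (the identity is allowed) each of whose fixed points
is labelled `+` or `-`, with (number of `+`) - (number of `-`) equal to `p - q`. The labelling is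
recorded by the set `plus` of fixed points labelled `+` and the set `minus` of those labelled `-`. -/
@[ext]
structure Clan (p q : ℕ) where
  perm : Equiv.Perm (Fin (p + q))
  plus : Finset (Fin (p + q))
  minus : Finset (Fin (p + q))
  perm_perm : ∀ x, perm (perm x) = x
  fixed_iff : ∀ x, perm x = x ↔ x ∈ plus ∨ x ∈ minus
  disj : Disjoint plus minus
  card_sub : (plus.card : ℤ) - (minus.card : ℤ) = (p : ℤ) - (q : ℤ)

namespace Clan

variable {p q : ℕ}

/-- Conjugation of a clan by a permutation `s`: matched pairs and signs are carried along by `s`. -/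
def conj (γ : Clan p q) (s : Equiv.Perm (Fin (p + q))) : Clan p q where
  perm := s * γ.perm * s⁻¹
  plus := γ.plus.map s.toEmbedding
  minus := γ.minus.map s.toEmbedding
  perm_perm x := by simp [γ.perm_perm]
  fixed_iff x := by
    have h := γ.fixed_iff (s⁻¹ x)
    simp only [Equiv.Perm.mul_apply, Finset.mem_map_equiv]
    rw [← Equiv.Perm.eq_inv_iff_eq]
    exact h
  disj := (Finset.disjoint_map _).2 γ.disj
  card_sub := by simpa using γ.card_sub

/-- `x` and `y` are fixed points of opposite sign. -/
def OppFixed (γ : Clan p q) (x y : Fin (p + q)) : Prop :=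
  (x ∈ γ.plus ∧ y ∈ γ.minus) ∨ (x ∈ γ.minus ∧ y ∈ γ.plus)

instance (γ : Clan p q) (x y : Fin (p + q)) : Decidable (γ.OppFixed x y) := by
  unfold OppFixed; infer_instance

theorem oppFixed_fixed (γ : Clan p q) {x y : Fin (p + q)} (h : γ.OppFixed x y) :
    γ.perm x = x ∧ γ.perm y = y ∧ x ≠ y := by
  rcases h with ⟨h1, h2⟩ | ⟨h1, h2⟩
  · exact ⟨(γ.fixed_iff x).2 (Or.inl h1), (γ.fixed_iff y).2 (Or.inr h2),
      fun e => Finset.disjoint_left.1 γ.disj h1 (e ▸ h2)⟩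
  · exact ⟨(γ.fixed_iff x).2 (Or.inr h1), (γ.fixed_iff y).2 (Or.inl h2),
      fun e => Finset.disjoint_left.1 γ.disj h2 (e ▸ h1)⟩

/-- The clan obtained by matching two fixed points of opposite sign, all else unchanged. -/
def matchFixed (γ : Clan p q) (x y : Fin (p + q)) (h : γ.OppFixed x y) : Clan p q where
  perm := Equiv.swap x y * γ.perm
  plus := γ.plus \ {x, y}
  minus := γ.minus \ {x, y}
  perm_perm z := by
    obtain ⟨hx, hy, -⟩ := γ.oppFixed_fixed h
    have hc : γ.perm * Equiv.swap x y = Equiv.swap x y * γ.perm := by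
      rw [Equiv.mul_swap_eq_swap_mul, hx, hy]
    have h2 : (Equiv.swap x y * γ.perm) * (Equiv.swap x y * γ.perm) = 1 := by
      have h3 : γ.perm * γ.perm = 1 := Equiv.ext γ.perm_perm
      rw [mul_assoc, ← mul_assoc γ.perm, hc, mul_assoc, h3, mul_one, Equiv.swap_mul_self]
    exact congrArg (fun f : Equiv.Perm (Fin (p + q)) => f z) h2
  fixed_iff z := by
    obtain ⟨hx, hy, hne⟩ := γ.oppFixed_fixed h
    have hz := γ.fixed_iff z
    simp only [Equiv.Perm.mul_apply, Finset.mem_sdiff, Finset.mem_insert, Finset.mem_singleton]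
    by_cases h1 : z = x
    · subst h1
      simp [hx, hne.symm]
    by_cases h2 : z = y
    · subst h2
      simp [hy, hne]
    have h3 : γ.perm z ≠ x := fun e => h1 (γ.perm.injective (e.trans hx.symm))
    have h4 : γ.perm z ≠ y := fun e => h2 (γ.perm.injective (e.trans hy.symm))
    rw [Equiv.swap_apply_of_ne_of_ne h3 h4, hz]
    simp [h1, h2]
  disj := γ.disj.mono Finset.sdiff_subset Finset.sdiff_subset
  card_sub := by
    have key : ∀ (A B : Finset (Fin (p + q))), Disjoint A B → ∀ a b, a ∈ A → b ∈ B →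
        ((A \ {a, b}).card : ℤ) = A.card - 1 ∧ ((B \ {a, b}).card : ℤ) = B.card - 1 := by
      intro A B hAB a b ha hb
      have hbA : b ∉ A := fun hh => Finset.disjoint_left.1 hAB hh hb
      have haB : a ∉ B := fun hh => Finset.disjoint_left.1 hAB ha hh
      have e1 : A \ {a, b} = A.erase a := by
        ext z
        simp only [Finset.mem_sdiff, Finset.mem_insert, Finset.mem_singleton, Finset.mem_erase]
        constructor
        · tauto
        · rintro ⟨h1, h2⟩
          exact ⟨h2, fun hh => hh.elim h1 (fun e => hbA (e ▸ h2))⟩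
      have e2 : B \ {a, b} = B.erase b := by
        ext z
        simp only [Finset.mem_sdiff, Finset.mem_insert, Finset.mem_singleton, Finset.mem_erase]
        constructor
        · tauto
        · rintro ⟨h1, h2⟩
          exact ⟨h2, fun hh => hh.elim (fun e => haB (e ▸ h2)) h1⟩
      rw [e1, e2]
      have c1 := Finset.card_erase_add_one ha
      have c2 := Finset.card_erase_add_one hb
      omega
    have hc := γ.card_sub
    rcases h with ⟨h1, h2⟩ | ⟨h1, h2⟩
    · have := key _ _ γ.disj x y h1 h2
      omega
    · have := key _ _ γ.disj.symm x y h1 h2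
      omega

/-- The partial operation `γ ∗ s_i` (for `1 ≤ i < n`; `none` means undefined). If `i`, `i+1` are
fixed points of opposite sign they become matched. If they are fixed points of equal sign, or
matched with each other, the result is undefined. In all other cases it is `s_i γ s_i`. -/
def star (γ : Clan p q) (i : ℕ) : Option (Clan p q) :=
  if hi : 1 ≤ i ∧ i < p + q then
    let x : Fin (p + q) := ⟨i - 1, by omega⟩
    let y : Fin (p + q) := ⟨i, hi.2⟩
    if h : γ.OppFixed x y then some (γ.matchFixed x y h)
    else if γ.perm x = y ∨ (γ.perm x = x ∧ γ.perm y = y) then none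
    else some (γ.conj (adjSwap (p + q) i))
  else none

/-- The weak order (strict): the transitive closure of `γ ∗ s_i < γ` whenever `γ ∗ s_i` is defined
and its underlying involution is longer than that of `γ`. -/
def WeakLT : Clan p q → Clan p q → Prop :=
  Relation.TransGen fun δ γ =>
    ∃ i, γ.star i = some δ ∧ permLength γ.perm < permLength δ.perm

/-- The covering relations of the weak order. -/
def WeakCovBy (δ γ : Clan p q) : Prop :=
  WeakLT δ γ ∧ ∀ ε, ¬ (WeakLT δ ε ∧ WeakLT ε γ)

/-- The underlying involution of `γ_{p,q}`. -/
def baseFun (p q : ℕ) (x : Fin (p + q)) : Fin (p + q) :=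
  if x.val < min p q ∨ p + q - min p q ≤ x.val then x.rev else x

theorem baseFun_involutive (p q : ℕ) : Function.Involutive (baseFun p q) := by
  intro x
  have hx := x.isLt
  unfold baseFun
  ext
  split_ifs with _ h2
  · simp
  · simp only [Fin.val_rev] at h2
    omega
  · rfl

/-- The unmatched points `m+1, ..., n-m` of `γ_{p,q}`. -/
def baseFixed (p q : ℕ) : Finset (Fin (p + q)) :=
  Finset.univ.filter fun x => min p q ≤ x.val ∧ x.val < p + q - min p q

theorem card_baseFixed (p q : ℕ) : (baseFixed p q).card = p + q - min p q - min p q := by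
  have h : (baseFixed p q).map Fin.valEmbedding = Finset.Ico (min p q) (p + q - min p q) := by
    ext k
    simp only [baseFixed, Finset.mem_map, Finset.mem_filter, Finset.mem_univ, true_and,
      Fin.valEmbedding_apply, Finset.mem_Ico]
    constructor
    · rintro ⟨x, hx, rfl⟩
      exact hx
    · intro hk
      exact ⟨⟨k, by omega⟩, hk, rfl⟩
  rw [← Finset.card_map Fin.valEmbedding, h, Nat.card_Ico]

/-- The minimal clan `γ_{p,q}`: with `m = min(p,q)` its underlying involution is
`(1 n)(2 n-1)⋯(m n-m+1)`, and the remaining points are fixed points labelled with the sign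
of `p - q` (there are none if `p = q`). -/
def base (p q : ℕ) : Clan p q where
  perm := (baseFun_involutive p q).toPerm
  plus := if q < p then baseFixed p q else ∅
  minus := if p < q then baseFixed p q else ∅
  perm_perm x := baseFun_involutive p q x
  fixed_iff x := by
    have hx := x.isLt
    change baseFun p q x = x ↔ _
    have h1 : baseFun p q x = x ↔ min p q ≤ x.val ∧ x.val < p + q - min p q := by
      unfold baseFun
      split_ifs with h
      · rw [Fin.ext_iff, Fin.val_rev]
        omega
      · simp only [true_iff]
        omega
    have h2 : x ∈ baseFixed p q ↔ min p q ≤ x.val ∧ x.val < p + q - min p q := by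
      simp [baseFixed]
    rw [h1, ← h2]
    rcases lt_trichotomy p q with h | h | h
    · simp [h, h.not_gt]
    · have : x ∉ baseFixed p q := by rw [h2]; omega
      simp [h, this]
    · simp [h, h.not_gt]
  disj := by
    rcases lt_trichotomy p q with h | h | h
    · simp [h.not_gt]
    · simp [h]
    · simp [h.not_gt]
  card_sub := by
    have hc := card_baseFixed p q
    rcases lt_trichotomy p q with h | h | h
    · rw [if_neg h.not_gt, if_pos h, hc]
      simp only [Finset.card_empty]
      omega
    · subst h
      simp
    · rw [if_neg h.not_gt, if_pos h, hc]
      simp only [Finset.card_empty]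
      omega

/-- `a_1 ⋯ a_ℓ` is a reduced word for `γ`: there is a saturated chain of the weak order from
`γ_{p,q}` to `γ` whose successive edges `δ ⋖ γ'`, `δ = γ' ∗ s_i`, have labels `a_1, ..., a_ℓ`. -/
inductive IsReducedWord : Clan p q → List ℕ → Prop
  | nil : IsReducedWord (base p q) []
  | snoc {δ γ : Clan p q} {a : List ℕ} {i : ℕ} (h : IsReducedWord δ a)
      (hcov : WeakCovBy δ γ) (hi : γ.star i = some δ) : IsReducedWord γ (a ++ [i])

/-- The set `R(γ)` of reduced words of a clan. -/
def reducedWords (γ : Clan p q) : Set (List ℕ) := {a | IsReducedWord γ a}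

/-- The atoms of `γ`: the permutations all of whose reduced words are reduced words of `γ`. This is
the only set `A` of permutations that can satisfy `R(γ) = ⋃_{w ∈ A} R(w)`, by
`Clan.eq_atoms_of_reducedWords_eq` below. -/
def atoms (γ : Clan p q) : Set (Equiv.Perm (Fin (p + q))) :=
  {w | permReducedWords w ⊆ γ.reducedWords}

theorem exists_word {n : ℕ} (w : Equiv.Perm (Fin n)) : ∃ a, IsWord n a ∧ wordProd n a = w := by
  cases n with
  | zero => exact ⟨[], by simp [IsWord], Subsingleton.elim _ _⟩
  | succ n =>
    have hw : w ∈ Submonoid.closure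
        (Set.range fun i : Fin n => Equiv.swap i.castSucc i.succ) := by
      rw [Equiv.Perm.mclosure_swap_castSucc_succ]
      trivial
    induction hw using Submonoid.closure_induction with
    | mem x hx =>
      obtain ⟨i, rfl⟩ := hx
      have hi : 1 ≤ i.val + 1 ∧ i.val + 1 < n + 1 := ⟨by omega, by omega⟩
      refine ⟨[i.val + 1], by simp [IsWord], ?_⟩
      simp only [wordProd, List.map_cons, List.map_nil, List.prod_singleton, adjSwap, dif_pos hi]
      congr 1
    | one => exact ⟨[], by simp [IsWord], by simp [wordProd]⟩
    | mul x y _ _ hx hy =>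
      obtain ⟨a, ha, rfl⟩ := hx
      obtain ⟨b, hb, rfl⟩ := hy
      refine ⟨a ++ b, ?_, by simp [wordProd]⟩
      intro k hk
      rcases List.mem_append.1 hk with h | h
      · exact ha k h
      · exact hb k h

theorem permReducedWords_nonempty {n : ℕ} (w : Equiv.Perm (Fin n)) :
    (permReducedWords w).Nonempty := by
  classical
  have h : ∃ l : ℕ, ∃ a : List ℕ, IsWord n a ∧ wordProd n a = w ∧ a.length = l := by
    obtain ⟨a, ha, hw⟩ := exists_word w
    exact ⟨_, a, ha, hw, rfl⟩
  obtain ⟨a, ha, hw, hl⟩ := Nat.find_spec h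
  refine ⟨a, ha, hw, fun b hb hbw => ?_⟩
  rw [hl]
  exact Nat.find_min' h ⟨b, hb, hbw, rfl⟩

theorem eq_atoms_of_reducedWords_eq (γ : Clan p q) (A : Set (Equiv.Perm (Fin (p + q))))
    (hA : γ.reducedWords = ⋃ w ∈ A, permReducedWords w) : A = γ.atoms := by
  ext w
  constructor
  · intro hw a ha
    rw [hA]
    exact Set.mem_biUnion hw ha
  · intro hw
    obtain ⟨a, ha⟩ := permReducedWords_nonempty w
    have h := hw ha
    rw [hA] at h
    simp only [Set.mem_iUnion] at h
    obtain ⟨w', hw', ha'⟩ := h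
    have : w' = w := ha'.2.1.symm.trans ha.2.1
    exact this ▸ hw'

end Clan

/-- The set `Γ(w)` of `(p,q)`-clans of which `w` is an atom. -/
def clansOf (p q : ℕ) (w : Equiv.Perm (Fin (p + q))) : Set (Clan p q) := {γ | w ∈ γ.atoms}

/-- The permutations that are atoms for some member of `Clan_{p,q}`. -/
def ClanAtom (p q : ℕ) : Type :=
  {w : Equiv.Perm (Fin (p + q)) // ∃ γ : Clan p q, w ∈ γ.atoms}

namespace ClanAtom

variable {p q : ℕ}

/-- The equivalence relation `v ∼ w` on atoms: they are atoms of exactly the same clans. -/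
def Equivalent (v w : ClanAtom p q) : Prop := clansOf p q v.1 = clansOf p q w.1

/-- The elementary relation between `u` and `s_k s_{n-k} u` of the same length, where
`1 ≤ k < min(p,q)`. It is symmetric, as `s_k` and `s_{n-k}` commute. -/
def Step (u v : ClanAtom p q) : Prop :=
  ∃ k, 1 ≤ k ∧ k < min p q ∧ v.1 = adjSwap (p + q) k * adjSwap (p + q) (p + q - k) * u.1 ∧
    permLength v.1 = permLength u.1

end ClanAtom

/-- The arcs of the (labelled) shape of `w`, without labels: the pairs
`{w⁻¹(k), w⁻¹(n-k+1)}` for `k = 1, ..., min(p,q)`. -/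
def shapeArcs (p q : ℕ) (w : Equiv.Perm (Fin (p + q))) : Set (Sym2 (Fin (p + q))) :=
  {e | ∃ c : Fin (p + q), c.val < min p q ∧ e = s(w⁻¹ c, w⁻¹ c.rev)}

/-- The endpoints of the marked arcs: the arc `{w⁻¹(k), w⁻¹(n-k+1)}` is marked if
`w⁻¹(k) > w⁻¹(n-k+1)`. -/
def shapeMarked (p q : ℕ) (w : Equiv.Perm (Fin (p + q))) : Set (Fin (p + q)) :=
  {x | ∃ c : Fin (p + q), c.val < min p q ∧ w⁻¹ c.rev < w⁻¹ c ∧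
    (x = w⁻¹ c ∨ x = w⁻¹ c.rev)}

/-- The unlabelled shape of `w`: a partial matching of `[n]`, given by its set of arcs, together
with the set of endpoints of its marked arcs. -/
def unlabelledShape (p q : ℕ) (w : Equiv.Perm (Fin (p + q))) :
    Set (Sym2 (Fin (p + q))) × Set (Fin (p + q)) :=
  (shapeArcs p q w, shapeMarked p q w)

/-! Everything rests on an explicit description of atoms, `Clan.mem_atoms_iff`. Let m = min(p,q). In
a permutation w the positions labelled k and n-k+1, for k ≤ m, form an arc, directed from the small
label to the large one and marked if it points left; the remaining positions form the core. Then w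
is an atom of γ iff two conditions hold: `IsAdmissible`, which concerns w alone, and `Compatible`,
which asks that unmarked arcs be matched in γ, that marked arcs join fixed points of opposite sign,
and that core points carry the sign of p-q. Compatibility sees the directed arcs but not their
labels.

The description is proved by induction on reduced words. Both conditions survive the removal of a
descent of w (`IsAdmissible.mul_swap_of_gt`, `Compatible.exists_star`) and a step up the weak order
(`IsAdmissible.mul_swap_of_matches`, `Compatible.of_star`); the identity corresponds to γ_{p,q}.

Hence atoms with the same directed arcs are equivalent. Conversely the compatible clans determine
the directed arcs (`Clan.isArc_of_compatible`), which gives (3).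

For (1) and (2), s_k s_{n-k} exchanges the labels of two arcs with consecutive labels and keeps all
arcs. Admissibility forces the relative order of the labels of arcs a→b and c→d only when a < c and
d < b, or the reverse. The exchange preserves length exactly when a < c ⇔ b < d, that is, when no
order is forced, so it preserves admissibility. If v and w are admissible with the same arcs, a
descent of w v⁻¹ yields two consecutive arcs occurring in both orders; exchanging them in v shortens
w v⁻¹. -/

/-! ### Inversions, descents and reduced words of permutations -/

/-- An adjacent transposition preserves the order of every pair of positions other than the one it
swaps, so it carries the old inversions to new ones and creates just one more. -/
theorem mem_permInversions_swap {n : ℕ} (w : Equiv.Perm (Fin n)) {x y : Fin n}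
    (hxy : y.val = x.val + 1) (h : w x < w y) (a b : Fin n) :
    (a < b ∧ (w * Equiv.swap x y) b < (w * Equiv.swap x y) a) ↔
      (a = x ∧ b = y) ∨ (Equiv.swap x y a < Equiv.swap x y b ∧
        w (Equiv.swap x y b) < w (Equiv.swap x y a)) := by
  have hne : x ≠ y := by intro e; subst e; omega
  simp only [Equiv.Perm.mul_apply, Equiv.swap_apply_def]
  by_cases h1 : a = x <;> by_cases h2 : a = y <;> by_cases h3 : b = x <;> by_cases h4 : b = y <;>
    simp_all <;> omega

theorem permLength_mul_swap {n : ℕ} (w : Equiv.Perm (Fin n)) {x y : Fin n}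
    (hxy : y.val = x.val + 1) (h : w x < w y) :
    permLength (w * Equiv.swap x y) = permLength w + 1 := by
  have hne : x ≠ y := by intro e; subst e; omega
  have hlt : x < y := by rw [Fin.lt_def]; omega
  unfold permLength
  let e : (Fin n × Fin n) ≃ (Fin n × Fin n) :=
    (Equiv.swap x y).prodCongr (Equiv.swap x y)
  have key : (Finset.univ.filter (fun z : Fin n × Fin n => z.1 < z.2 ∧
      (w * Equiv.swap x y) z.2 < (w * Equiv.swap x y) z.1)) =
      insert (x, y) ((Finset.univ.filter
        (fun z : Fin n × Fin n => z.1 < z.2 ∧ w z.2 < w z.1)).map e.toEmbedding) := by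
    ext ⟨a, b⟩
    have := mem_permInversions_swap w hxy h a b
    simp only [Finset.mem_filter, Finset.mem_univ, true_and, Finset.mem_insert,
      Finset.mem_map_equiv, Prod.mk.injEq]
    rw [this]
    simp [e]
  rw [key, Finset.card_insert_of_notMem, Finset.card_map]
  simp only [Finset.mem_map_equiv, Finset.mem_filter, Finset.mem_univ, true_and]
  simp [e, hlt.le]

theorem permLength_inv {n : ℕ} (w : Equiv.Perm (Fin n)) : permLength w⁻¹ = permLength w := by
  unfold permLength
  refine Finset.card_bij (fun z _ => (w⁻¹ z.2, w⁻¹ z.1)) ?_ ?_ ?_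
  · rintro ⟨a, b⟩ h
    simpa [and_comm] using h
  · rintro ⟨a, b⟩ _ ⟨c, d⟩ _ h
    simpa [and_comm] using h
  · rintro ⟨a, b⟩ h
    exact ⟨(w b, w a), by simpa [and_comm] using h, by simp⟩

theorem permLength_mul_swap_of_gt {n : ℕ} (w : Equiv.Perm (Fin n)) {x y : Fin n}
    (hxy : y.val = x.val + 1) (h : w y < w x) :
    permLength (w * Equiv.swap x y) + 1 = permLength w := by
  have := permLength_mul_swap (w * Equiv.swap x y) hxy (by simpa using h)
  rw [← this, mul_assoc, Equiv.swap_mul_self, mul_one]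

theorem permLength_swap_mul {n : ℕ} (w : Equiv.Perm (Fin n)) {x y : Fin n}
    (hxy : y.val = x.val + 1) (h : w⁻¹ x < w⁻¹ y) :
    permLength (Equiv.swap x y * w) = permLength w + 1 := by
  rw [← permLength_inv, mul_inv_rev, Equiv.swap_inv, permLength_mul_swap _ hxy h, permLength_inv]

theorem permLength_swap_mul_of_gt {n : ℕ} (w : Equiv.Perm (Fin n)) {x y : Fin n}
    (hxy : y.val = x.val + 1) (h : w⁻¹ y < w⁻¹ x) :
    permLength (Equiv.swap x y * w) + 1 = permLength w := by
  rw [← permLength_inv, mul_inv_rev, Equiv.swap_inv, permLength_mul_swap_of_gt _ hxy h,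
    permLength_inv]

theorem adjSwap_eq {n : ℕ} {x y : Fin n} (hxy : y.val = x.val + 1) :
    adjSwap n y.val = Equiv.swap x y := by
  have hy := y.isLt
  rw [adjSwap, dif_pos ⟨by omega, hy⟩]
  congr 1
  ext
  simp [hxy]

theorem exists_adjacent {n k : ℕ} (h : 1 ≤ k ∧ k < n) :
    ∃ x y : Fin n, y.val = x.val + 1 ∧ y.val = k :=
  ⟨⟨k - 1, by omega⟩, ⟨k, h.2⟩, by simp; omega, rfl⟩

/-- A permutation other than the identity has a descent. -/
theorem exists_descent {n : ℕ} {w : Equiv.Perm (Fin n)} (hw : w ≠ 1) :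
    ∃ x y : Fin n, y.val = x.val + 1 ∧ w y < w x := by
  by_contra! hcon
  apply hw
  have hmono : StrictMono w := by
    cases n with
    | zero => exact fun a => a.elim0
    | succ n =>
      rw [Fin.strictMono_iff_lt_succ]
      intro i
      refine lt_of_le_of_ne (hcon _ _ (by simp)) fun e => ?_
      exact (Fin.castSucc_lt_succ (i := i)).ne (w.injective e)
  ext x
  -- The only order automorphism of a finite chain is the identity.
  have : (hmono.orderIsoOfSurjective w w.surjective) = OrderIso.refl _ := Subsingleton.elim _ _
  have h2 := congrArg (fun f : Fin n ≃o Fin n => f x) this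
  simpa using congrArg Fin.val h2

theorem wordProd_concat (n : ℕ) (a : List ℕ) (i : ℕ) :
    wordProd n (a ++ [i]) = wordProd n a * adjSwap n i := by
  simp [wordProd]

theorem isWord_concat {n : ℕ} {a : List ℕ} {i : ℕ} :
    IsWord n (a ++ [i]) ↔ IsWord n a ∧ 1 ≤ i ∧ i < n := by
  simp only [IsWord, List.mem_append, List.mem_singleton]
  constructor
  · exact fun h => ⟨fun k hk => h k (Or.inl hk), h i (Or.inr rfl)⟩
  · rintro ⟨h, hi⟩ k (hk | rfl)
    exacts [h k hk, hi]

theorem permLength_one (n : ℕ) : permLength (1 : Equiv.Perm (Fin n)) = 0 := by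
  simp only [permLength, Finset.card_eq_zero, Finset.filter_eq_empty_iff]
  rintro ⟨a, b⟩ - ⟨h1, h2⟩
  exact absurd h1 (not_lt.2 (le_of_lt h2))

theorem permLength_wordProd_le {n : ℕ} (a : List ℕ) (ha : IsWord n a) :
    permLength (wordProd n a) ≤ a.length := by
  induction a using List.reverseRecOn with
  | nil => simp [wordProd, permLength_one]
  | append_singleton a i ih =>
    rw [isWord_concat] at ha
    obtain ⟨x, y, hxy, rfl⟩ := exists_adjacent ha.2
    rw [wordProd_concat, adjSwap_eq hxy, List.length_append, List.length_singleton]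
    have := ih ha.1
    rcases lt_trichotomy (wordProd n a x) (wordProd n a y) with h | h | h
    · rw [permLength_mul_swap _ hxy h]
      omega
    · have := (wordProd n a).injective h
      subst this
      omega
    · have := permLength_mul_swap_of_gt _ hxy h
      omega

/-- Removing descents one at a time reaches the identity. With `permLength_wordProd_le` this
identifies the length of a reduced word with the number of inversions. -/
theorem exists_word_length_eq {n : ℕ} (w : Equiv.Perm (Fin n)) :
    ∃ a, IsWord n a ∧ wordProd n a = w ∧ a.length = permLength w := by
  induction h : permLength w using Nat.strong_induction_on generalizing w with
  | _ l ih =>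
    subst h
    by_cases hw : w = 1
    · subst hw
      exact ⟨[], by simp [IsWord], by simp [wordProd], by simp [permLength_one]⟩
    · obtain ⟨x, y, hxy, hd⟩ := exists_descent hw
      have hl := permLength_mul_swap_of_gt _ hxy hd
      obtain ⟨a, ha, hp, hla⟩ := ih _ (by omega) (w * Equiv.swap x y) rfl
      refine ⟨a ++ [y.val], isWord_concat.2 ⟨ha, by omega, y.isLt⟩, ?_, by simp; omega⟩
      rw [wordProd_concat, hp, adjSwap_eq hxy, mul_assoc, Equiv.swap_mul_self, mul_one]

/-- The last letter of a reduced word is a descent. -/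
theorem permReducedWords_concat {n : ℕ} {w : Equiv.Perm (Fin n)} {a : List ℕ} {i : ℕ}
    (h : a ++ [i] ∈ permReducedWords w) :
    ∃ x y : Fin n, y.val = x.val + 1 ∧ y.val = i ∧ w y < w x ∧
      a ∈ permReducedWords (w * Equiv.swap x y) := by
  obtain ⟨h1, h2, h3⟩ := h
  rw [isWord_concat] at h1
  obtain ⟨x, y, hxy, rfl⟩ := exists_adjacent h1.2
  rw [wordProd_concat, adjSwap_eq hxy] at h2
  have hp : wordProd n a = w * Equiv.swap x y := by
    rw [← h2, mul_assoc, Equiv.swap_mul_self, mul_one]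
  refine ⟨x, y, hxy, rfl, ?_, h1.1, hp, ?_⟩
  -- At an ascent, `w * swap x y` would have more inversions than `w`, and `a` could not be short
  -- enough for `a ++ [i]` to be reduced.
  · by_contra hcon
    have hne : w x ≠ w y := fun e => by have := w.injective e; subst this; omega
    have hl := permLength_mul_swap w hxy (lt_of_le_of_ne (not_lt.1 hcon) hne)
    have hle := permLength_wordProd_le a h1.1
    obtain ⟨b, hb, hbw, hbl⟩ := exists_word_length_eq w
    have := h3 b hb hbw
    simp only [List.length_append, List.length_singleton] at this
    rw [hp] at hle
    omega
  · intro b hb hbw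
    have := h3 (b ++ [y.val]) (isWord_concat.2 ⟨hb, h1.2⟩)
      (by rw [wordProd_concat, hbw, adjSwap_eq hxy, mul_assoc, Equiv.swap_mul_self, mul_one])
    simpa using this

/-! ### Arcs, core and admissible permutations -/

/-- `w` sends `a` and `b` to the labels `k` and `n - k + 1` for some `k ≤ m`. -/
def IsArc {n : ℕ} (m : ℕ) (w : Equiv.Perm (Fin n)) (a b : Fin n) : Prop :=
  (w a).val < m ∧ (w a).val + (w b).val + 1 = n

/-- The label of `x` belongs to no arc. -/
def IsCore {n : ℕ} (m : ℕ) (w : Equiv.Perm (Fin n)) (x : Fin n) : Prop :=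
  m ≤ (w x).val ∧ (w x).val + m < n

/-- The explicit description of atoms in one-line notation. An arc `a b` is marked if `b < a`. -/
structure IsAdmissible {n : ℕ} (m : ℕ) (w : Equiv.Perm (Fin n)) : Prop where
  core_lt : ∀ x y, IsCore m w x → IsCore m w y → x < y → w x < w y
  core_marked : ∀ x a b, IsCore m w x → IsArc m w a b → b < x → x < a → False
  unmarked_unmarked : ∀ a b c d, IsArc m w a b → IsArc m w c d → a < c → c < d → d < b → w a < w c
  unmarked_marked : ∀ a b c d, IsArc m w a b → IsArc m w c d → a < b → d < c → d < b → a < c →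
    w a < w c
  marked_marked : ∀ a b c d, IsArc m w a b → IsArc m w c d → b < d → d < c → c < a → w c < w a
  not_crossing : ∀ a b c d, IsArc m w a b → IsArc m w c d → b < d → d < a → a < c → False

theorem swap_lt_swap {n : ℕ} {x y : Fin n} (hxy : y.val = x.val + 1) {a b : Fin n} :
    Equiv.swap x y a < Equiv.swap x y b ↔ (a < b ∧ ¬ (a = x ∧ b = y)) ∨ (a = y ∧ b = x) := by
  have hne : x ≠ y := by intro e; subst e; omega
  simp only [Equiv.swap_apply_def]
  split_ifs <;> simp_all <;> omega

theorem isArc_mul_swap {n m : ℕ} (w : Equiv.Perm (Fin n)) (x y a b : Fin n) :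
    IsArc m (w * Equiv.swap x y) (Equiv.swap x y a) (Equiv.swap x y b) ↔ IsArc m w a b := by
  simp [IsArc]

/-- Reindexing by the swap keeps the arcs and labels of `w` and transports only the comparisons of
positions. By `swap_lt_swap` these change for the pair `x`, `y` alone, so stability under a swap
becomes a finite case check. -/
theorem isAdmissible_mul_swap_iff {n m : ℕ} (w : Equiv.Perm (Fin n)) (x y : Fin n) :
    IsAdmissible m (w * Equiv.swap x y) ↔
    (∀ a b, IsCore m w a → IsCore m w b → Equiv.swap x y a < Equiv.swap x y b → w a < w b) ∧
    (∀ e a b, IsCore m w e → IsArc m w a b → Equiv.swap x y b < Equiv.swap x y e →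
      Equiv.swap x y e < Equiv.swap x y a → False) ∧
    (∀ a b c d, IsArc m w a b → IsArc m w c d → Equiv.swap x y a < Equiv.swap x y c →
      Equiv.swap x y c < Equiv.swap x y d → Equiv.swap x y d < Equiv.swap x y b → w a < w c) ∧
    (∀ a b c d, IsArc m w a b → IsArc m w c d → Equiv.swap x y a < Equiv.swap x y b →
      Equiv.swap x y d < Equiv.swap x y c → Equiv.swap x y d < Equiv.swap x y b →
      Equiv.swap x y a < Equiv.swap x y c → w a < w c) ∧
    (∀ a b c d, IsArc m w a b → IsArc m w c d → Equiv.swap x y b < Equiv.swap x y d →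
      Equiv.swap x y d < Equiv.swap x y c → Equiv.swap x y c < Equiv.swap x y a → w c < w a) ∧
    (∀ a b c d, IsArc m w a b → IsArc m w c d → Equiv.swap x y b < Equiv.swap x y d →
      Equiv.swap x y d < Equiv.swap x y a → Equiv.swap x y a < Equiv.swap x y c → False) := by
  constructor
  · rintro ⟨h1, h2, h3, h4, h5, h6⟩
    simp only [IsCore, IsArc] at *
    refine ⟨fun a b => ?_, fun e a b => ?_, fun a b c d => ?_, fun a b c d => ?_,
      fun a b c d => ?_, fun a b c d => ?_⟩
    · simpa using h1 (Equiv.swap x y a) (Equiv.swap x y b)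
    · simpa using h2 (Equiv.swap x y e) (Equiv.swap x y a) (Equiv.swap x y b)
    · simpa using h3 (Equiv.swap x y a) (Equiv.swap x y b) (Equiv.swap x y c) (Equiv.swap x y d)
    · simpa using h4 (Equiv.swap x y a) (Equiv.swap x y b) (Equiv.swap x y c) (Equiv.swap x y d)
    · simpa using h5 (Equiv.swap x y a) (Equiv.swap x y b) (Equiv.swap x y c) (Equiv.swap x y d)
    · simpa using h6 (Equiv.swap x y a) (Equiv.swap x y b) (Equiv.swap x y c) (Equiv.swap x y d)
  · rintro ⟨h1, h2, h3, h4, h5, h6⟩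
    simp only [IsCore, IsArc] at *
    constructor <;> simp only [IsCore, IsArc]
    · refine fun a b => ?_
      simpa using h1 (Equiv.swap x y a) (Equiv.swap x y b)
    · refine fun e a b => ?_
      simpa using h2 (Equiv.swap x y e) (Equiv.swap x y a) (Equiv.swap x y b)
    · refine fun a b c d => ?_
      simpa using h3 (Equiv.swap x y a) (Equiv.swap x y b) (Equiv.swap x y c) (Equiv.swap x y d)
    · refine fun a b c d => ?_
      simpa using h4 (Equiv.swap x y a) (Equiv.swap x y b) (Equiv.swap x y c) (Equiv.swap x y d)
    · refine fun a b c d => ?_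
      simpa using h5 (Equiv.swap x y a) (Equiv.swap x y b) (Equiv.swap x y c) (Equiv.swap x y d)
    · refine fun a b c d => ?_
      simpa using h6 (Equiv.swap x y a) (Equiv.swap x y b) (Equiv.swap x y c) (Equiv.swap x y d)

theorem perm_val_congr {n : ℕ} (w : Equiv.Perm (Fin n)) (a b : Fin n) :
    a.val = b.val ↔ (w a).val = (w b).val := by
  rw [← Fin.ext_iff, ← Fin.ext_iff, w.apply_eq_iff_eq]

/-- Admissibility passes down along descents. -/
theorem IsAdmissible.mul_swap_of_gt {n m : ℕ} (hm : 2 * m ≤ n) {w : Equiv.Perm (Fin n)}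
    (hw : IsAdmissible m w)
    {x y : Fin n} (hxy : y.val = x.val + 1) (hd : w y < w x) :
    IsAdmissible m (w * Equiv.swap x y) := by
  obtain ⟨h1, h2, h3, h4, h5, h6⟩ := hw
  rw [isAdmissible_mul_swap_iff]
  simp only [swap_lt_swap hxy]
  refine ⟨fun a b ha hb h => ?_, fun e a b he hab h h' => ?_, ?_⟩
  · have := h1 a b ha hb
    rcases h with h | ⟨rfl, rfl⟩
    exacts [this h.1, hd]
  · have := h2 e a b he hab
    unfold IsCore at he
    unfold IsArc at hab
    have c1 := perm_val_congr w e x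
    have c2 := perm_val_congr w e y
    have c3 := perm_val_congr w a x
    have c4 := perm_val_congr w a y
    have c5 := perm_val_congr w b x
    have c6 := perm_val_congr w b y
    simp only [Fin.lt_def, Fin.ext_iff] at *
    clear h1 h2 h3 h4 h5 h6
    grind
  have key : ∀ a b c d, IsArc m w a b → IsArc m w c d →
      (a.val = c.val ↔ (w a).val = (w c).val) ∧ (b.val = d.val ↔ (w b).val = (w d).val) ∧
      (∀ z ∈ [a, b, c, d], (z.val = x.val → (w z).val = (w x).val) ∧
        (z.val = y.val → (w z).val = (w y).val)) :=
    fun a b c d _ _ => ⟨perm_val_congr w _ _, perm_val_congr w _ _,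
      fun z _ => ⟨(perm_val_congr w _ _).1, (perm_val_congr w _ _).1⟩⟩
  refine ⟨fun a b c d hab hcd => ?_, fun a b c d hab hcd => ?_, fun a b c d hab hcd => ?_,
    fun a b c d hab hcd => ?_⟩ <;>
  · obtain ⟨k1, k2, k3⟩ := key a b c d hab hcd
    simp only [List.forall_mem_cons, List.not_mem_nil, false_imp_iff, implies_true, and_true] at k3
    -- The swap may turn a marked arc with adjacent ends into an unmarked one, so the rule wanted
    -- after the swap can come from a different rule before it; all rules are supplied, for both
    -- orders of the two arcs.
    have h3 := And.intro (h3 a b c d hab hcd) (h3 c d a b hcd hab)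
    have h4 := And.intro (h4 a b c d hab hcd) (h4 c d a b hcd hab)
    have h5 := And.intro (h5 a b c d hab hcd) (h5 c d a b hcd hab)
    have h6 := And.intro (h6 a b c d hab hcd) (h6 c d a b hcd hab)
    clear h1 h2 key
    simp only [IsArc, Fin.lt_def, Fin.ext_iff] at *
    grind

/-! ### Admissibility and the matching by unmarked arcs -/

/-- The involution `f` matches the unmarked arcs of `w` and fixes all other points. -/
structure Matches {n : ℕ} (m : ℕ) (w f : Equiv.Perm (Fin n)) : Prop where
  core : ∀ x, IsCore m w x → f x = x
  unmarked : ∀ a b, IsArc m w a b → a < b → f a = b ∧ f b = a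
  marked : ∀ a b, IsArc m w a b → b < a → f a = a ∧ f b = b

/-- Admissibility passes up along descents of the matching. -/
theorem IsAdmissible.mul_swap_of_matches {n m : ℕ} {w f : Equiv.Perm (Fin n)}
    (hw : IsAdmissible m w) (hf : Matches m w f)
    {x y : Fin n} (hxy : y.val = x.val + 1) (hd : f y < f x) :
    IsAdmissible m (w * Equiv.swap x y) := by
  obtain ⟨h1, h2, h3, h4, h5, h6⟩ := hw
  obtain ⟨f1, f2, f3⟩ := hf
  rw [isAdmissible_mul_swap_iff]
  simp only [swap_lt_swap hxy]
  have kx : ∀ z, z.val = x.val → (f z).val = (f x).val := fun z => (perm_val_congr f z x).1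
  have ky : ∀ z, z.val = y.val → (f z).val = (f y).val := fun z => (perm_val_congr f z y).1
  refine ⟨fun a b ha hb h => ?_, fun e a b he hab h h' => ?_, ?_⟩
  · have := h1 a b ha hb
    have g1 := f1 a ha
    have g2 := f1 b hb
    rcases h with h | ⟨rfl, rfl⟩
    · exact this h.1
    · simp only [Fin.lt_def, Fin.ext_iff] at *
      omega
  · have := h2 e a b he hab
    have g1 := f1 e he
    have g2 := f2 a b hab
    have g3 := f3 a b hab
    unfold IsCore at he
    unfold IsArc at hab
    have c1 := kx a
    have c2 := ky a
    have c3 := kx b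
    have c4 := ky b
    have c5 := kx e
    have c6 := ky e
    clear h1 h2 h3 h4 h5 h6 f1 f2 f3 kx ky
    simp only [Fin.lt_def, Fin.ext_iff] at *
    grind
  have key : ∀ a b c d, IsArc m w a b → IsArc m w c d →
      (a.val = c.val ↔ (w a).val = (w c).val) ∧ (b.val = d.val ↔ (w b).val = (w d).val) ∧
      (∀ z ∈ [a, b, c, d], (z.val = x.val → (f z).val = (f x).val) ∧
        (z.val = y.val → (f z).val = (f y).val)) :=
    fun a b c d _ _ => ⟨perm_val_congr w _ _, perm_val_congr w _ _,
      fun z _ => ⟨kx z, ky z⟩⟩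
  refine ⟨fun a b c d hab hcd => ?_, fun a b c d hab hcd => ?_, fun a b c d hab hcd => ?_,
    fun a b c d hab hcd => ?_⟩ <;>
  · obtain ⟨k1, k2, k3⟩ := key a b c d hab hcd
    simp only [List.forall_mem_cons, List.not_mem_nil, false_imp_iff, implies_true, and_true] at k3
    -- Here the swap may turn an unmarked arc with adjacent ends into a marked one, so again rules
    -- of different types interact.
    have h3 := And.intro (h3 a b c d hab hcd) (h3 c d a b hcd hab)
    have h4 := And.intro (h4 a b c d hab hcd) (h4 c d a b hcd hab)
    have h5 := And.intro (h5 a b c d hab hcd) (h5 c d a b hcd hab)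
    have h6 := And.intro (h6 a b c d hab hcd) (h6 c d a b hcd hab)
    have f2 := And.intro (f2 a b hab) (f2 c d hcd)
    have f3 := And.intro (f3 a b hab) (f3 c d hcd)
    clear h1 h2 key f1 kx ky
    simp only [IsArc, Fin.lt_def, Fin.ext_iff] at *
    grind

theorem isCore_or_isArc {n : ℕ} (m : ℕ) (w : Equiv.Perm (Fin n)) (x : Fin n) :
    IsCore m w x ∨ (∃ y, IsArc m w x y) ∨ ∃ y, IsArc m w y x := by
  by_cases h1 : (w x).val < m
  · refine Or.inr (Or.inl ⟨w⁻¹ (w x).rev, h1, ?_⟩)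
    have := (w x).isLt
    simp
    omega
  · by_cases h2 : (w x).val + m < n
    · exact Or.inl ⟨not_lt.1 h1, h2⟩
    · have := (w x).isLt
      refine Or.inr (Or.inr ⟨w⁻¹ (w x).rev, ?_, ?_⟩) <;> simp <;> omega

/-- A descent of an admissible permutation not separating the ends of an arc is an ascent of the
matching, and does not separate two fixed points. -/
theorem IsAdmissible.matches_lt {n m : ℕ} (hm : 2 * m ≤ n) {w f : Equiv.Perm (Fin n)}
    (hw : IsAdmissible m w) (hf : Matches m w f) {x y : Fin n} (hxy : y.val = x.val + 1)
    (hd : w y < w x) (hyx : ¬ IsArc m w y x) : f x < f y ∧ ¬ (f x = x ∧ f y = y) := by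
  obtain ⟨h1, h2, h3, h4, h5, h6⟩ := hw
  obtain ⟨f1, f2, f3⟩ := hf
  have core : ∀ e a b, IsCore m w e → IsArc m w a b → (x = e ∧ (y = a ∨ y = b)) ∨
      (y = e ∧ (x = a ∨ x = b)) → f x < f y ∧ ¬ (f x = x ∧ f y = y) := by
    intro e a b he hab h
    have i1 := h2 e a b he hab
    have i2 := f1 e he
    have i3 := f2 a b hab
    have i4 := f3 a b hab
    have i5 := he
    have i6 := hab
    clear h1 h2 h3 h4 h5 h6 f1 f2 f3
    unfold IsCore at i5
    unfold IsArc at i6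
    have c1 := perm_val_congr w a b
    rcases h with ⟨rfl, rfl | rfl⟩ | ⟨rfl, rfl | rfl⟩ <;>
    · simp only [Fin.lt_def, Fin.ext_iff] at *
      grind
  have arcs : ∀ a b c d, IsArc m w a b → IsArc m w c d → (x = a ∨ x = b) → (y = c ∨ y = d) →
      f x < f y ∧ ¬ (f x = x ∧ f y = y) := by
    intro a b c d hab hcd hx hy
    have c1 := perm_val_congr w a b
    have c2 := perm_val_congr w a c
    have c3 := perm_val_congr w a d
    have c4 := perm_val_congr w b c
    have c5 := perm_val_congr w b d
    have c6 := perm_val_congr w c d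
    have c7 := lt_trichotomy a.val c.val
    replace h3 := And.intro (h3 a b c d hab hcd) (h3 c d a b hcd hab)
    replace h4 := And.intro (h4 a b c d hab hcd) (h4 c d a b hcd hab)
    replace h5 := And.intro (h5 a b c d hab hcd) (h5 c d a b hcd hab)
    replace h6 := And.intro (h6 a b c d hab hcd) (h6 c d a b hcd hab)
    replace f2 := And.intro (f2 a b hab) (f2 c d hcd)
    replace f3 := And.intro (f3 a b hab) (f3 c d hcd)
    clear h1 h2 f1 core
    simp only [IsArc] at *
    rcases hx with rfl | rfl <;> rcases hy with rfl | rfl <;>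
    · simp only [Fin.lt_def, Fin.ext_iff] at *
      grind
  rcases isCore_or_isArc m w x with hx | ⟨a, hx⟩ | ⟨a, hx⟩ <;>
  rcases isCore_or_isArc m w y with hy | ⟨c, hy⟩ | ⟨c, hy⟩
  · have := h1 x y hx hy
    simp only [Fin.lt_def] at *
    omega
  · exact core _ _ _ hx hy (by simp)
  · exact core _ _ _ hx hy (by simp)
  · exact core _ _ _ hy hx (by simp)
  · exact arcs _ _ _ _ hx hy (by simp) (by simp)
  · exact arcs _ _ _ _ hx hy (by simp) (by simp)
  · exact core _ _ _ hy hx (by simp)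
  · exact arcs _ _ _ _ hx hy (by simp) (by simp)
  · exact arcs _ _ _ _ hx hy (by simp) (by simp)

/-! ### Pairs of arcs whose labels may be exchanged -/

/-- Two arcs which appear in both orders can be exchanged without changing the length. -/
theorem IsAdmissible.lt_iff_lt {n m : ℕ} (hm : 2 * m ≤ n) {v w : Equiv.Perm (Fin n)}
    (hv : IsAdmissible m v) (hw : IsAdmissible m w) (hvw : ∀ a b, IsArc m v a b ↔ IsArc m w a b)
    {a b c d : Fin n} (hab : IsArc m v a b) (hcd : IsArc m v c d) (h : v a < v c)
    (h' : w c < w a) : a < c ↔ b < d := by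
  have hab' := (hvw _ _).1 hab
  have hcd' := (hvw _ _).1 hcd
  -- If `a < c` and `d < b`, the arcs are nested and both unmarked, nested and both marked, or the
  -- first is unmarked and the second marked; each time a rule forces the label of `a` below that of
  -- `c`, in `v` and in `w`. The case `c < a`, `b < d` is symmetric.
  have h3 := And.intro (hv.unmarked_unmarked a b c d hab hcd) (hv.unmarked_unmarked c d a b hcd hab)
  have h4 := And.intro (hv.unmarked_marked a b c d hab hcd) (hv.unmarked_marked c d a b hcd hab)
  have h5 := And.intro (hv.marked_marked a b c d hab hcd) (hv.marked_marked c d a b hcd hab)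
  have g3 := And.intro (hw.unmarked_unmarked a b c d hab' hcd')
    (hw.unmarked_unmarked c d a b hcd' hab')
  have g4 := And.intro (hw.unmarked_marked a b c d hab' hcd') (hw.unmarked_marked c d a b hcd' hab')
  have g5 := And.intro (hw.marked_marked a b c d hab' hcd') (hw.marked_marked c d a b hcd' hab')
  have c1 := perm_val_congr v a b
  have c2 := perm_val_congr v a c
  have c3 := perm_val_congr v a d
  have c4 := perm_val_congr v b c
  have c5 := perm_val_congr v b d
  have c6 := perm_val_congr v c d
  clear hv hw hvw hab' hcd'
  simp only [IsArc, Fin.lt_def] at *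
  grind

/-- Admissibility survives an exchange of the labels of two arcs with consecutive labels. -/
theorem IsAdmissible.exchange {n m : ℕ} {v v' : Equiv.Perm (Fin n)}
    (hv : IsAdmissible m v) (harc : ∀ a b, IsArc m v' a b ↔ IsArc m v a b)
    (hcore : ∀ x, IsCore m v' x → IsCore m v x ∧ v' x = v x)
    {a b c d : Fin n} (hab : IsArc m v a b) (hcd : IsArc m v c d)
    (hlt : a < c ↔ b < d) (hord : ∀ e f g h, IsArc m v e f → IsArc m v g h → v e < v g →
      v' e < v' g ∨ (e = a ∧ g = c)) : IsAdmissible m v' := by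
  have hb : ∀ e, IsArc m v a e → e = b := by
    intro e he
    have := perm_val_congr v e b
    unfold IsArc at he hab
    exact Fin.ext (this.2 (by omega))
  have hd : ∀ e, IsArc m v c e → e = d := by
    intro e he
    have := perm_val_congr v e d
    unfold IsArc at he hcd
    exact Fin.ext (this.2 (by omega))
  constructor
  · intro x y hx hy hxy
    rw [(hcore x hx).2, (hcore y hy).2]
    exact hv.core_lt _ _ (hcore x hx).1 (hcore y hy).1 hxy
  · intro x e f hx hef
    exact hv.core_marked _ _ _ (hcore x hx).1 ((harc _ _).1 hef)
  · intro e f g h hef hgh i1 i2 i3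
    rw [harc] at hef hgh
    -- Only the two exchanged arcs reverse their order. An ordering rule applies to them only if `a
    -- < c` and `d < b`, which `hlt` excludes.
    rcases hord e f g h hef hgh (hv.unmarked_unmarked _ _ _ _ hef hgh i1 i2 i3) with h | ⟨rfl, rfl⟩
    · exact h
    · obtain rfl := hb _ hef
      obtain rfl := hd _ hgh
      exact absurd (hlt.1 i1) i3.not_gt
  · intro e f g h hef hgh i1 i2 i3 i4
    rw [harc] at hef hgh
    rcases hord e f g h hef hgh (hv.unmarked_marked _ _ _ _ hef hgh i1 i2 i3 i4) with h | ⟨rfl, rfl⟩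
    · exact h
    · obtain rfl := hb _ hef
      obtain rfl := hd _ hgh
      exact absurd (hlt.1 i4) i3.not_gt
  · intro e f g h hef hgh i1 i2 i3
    rw [harc] at hef hgh
    rcases hord g h e f hgh hef (hv.marked_marked _ _ _ _ hef hgh i1 i2 i3) with h | ⟨rfl, rfl⟩
    · exact h
    · obtain rfl := hb _ hgh
      obtain rfl := hd _ hef
      exact absurd (hlt.1 i3) i1.not_gt
  · intro e f g h hef hgh
    rw [harc] at hef hgh
    exact hv.not_crossing _ _ _ _ hef hgh

/-! ### Elementary facts on arcs -/

theorem isAdmissible_one {n : ℕ} (m : ℕ) : IsAdmissible m (1 : Equiv.Perm (Fin n)) := by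
  constructor <;> simp only [IsCore, IsArc, Equiv.Perm.coe_one, id_eq, Fin.lt_def] <;> intros <;> omega

/-- As `2 * m ≤ n`, the small and the large arc labels are disjoint, so a position is an end of at
most one arc and in only one role. Applied to an arc and itself, it shows that the two ends differ.
-/
theorem IsArc.eq_iff {n m : ℕ} (hm : 2 * m ≤ n) {w : Equiv.Perm (Fin n)} {a b c d : Fin n}
    (hab : IsArc m w a b) (hcd : IsArc m w c d) : (a = c ↔ b = d) ∧ a ≠ d ∧ b ≠ c := by
  have c2 := perm_val_congr w a c
  have c3 := perm_val_congr w a d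
  have c4 := perm_val_congr w b c
  have c5 := perm_val_congr w b d
  simp only [IsArc, Fin.ext_iff, ne_eq] at *
  omega

theorem IsArc.ne_of_isCore {n m : ℕ} {w : Equiv.Perm (Fin n)} {a b c : Fin n}
    (hab : IsArc m w a b) (hc : IsCore m w c) : c ≠ a ∧ c ≠ b := by
  unfold IsArc at hab
  unfold IsCore at hc
  refine ⟨?_, ?_⟩ <;>
  · rintro rfl
    omega

theorem isArc_swap_cases {n m : ℕ} (hm : 2 * m ≤ n) {w : Equiv.Perm (Fin n)} {x y a b : Fin n}
    (hyx : IsArc m w y x) (hab : IsArc m (w * Equiv.swap x y) a b) :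
    (a = x ∧ b = y) ∨ (IsArc m w a b ∧ a ≠ x ∧ a ≠ y ∧ b ≠ x ∧ b ≠ y) := by
  have h : IsArc m w (Equiv.swap x y a) (Equiv.swap x y b) := hab
  have h1 := IsArc.eq_iff hm h hyx
  by_cases hax : a = x
  · subst hax
    rw [Equiv.swap_apply_left] at h1
    have h2 := h1.1.1 rfl
    rw [Equiv.swap_apply_eq_iff, Equiv.swap_apply_left] at h2
    exact Or.inl ⟨rfl, h2⟩
  · have hay : a ≠ y := by
      rintro rfl
      exact h1.2.1 (Equiv.swap_apply_right _ _)
    rw [Equiv.swap_apply_of_ne_of_ne hax hay] at h h1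
    have hbx : b ≠ x := by
      rintro rfl
      exact h1.2.2 (Equiv.swap_apply_left _ _)
    have hby : b ≠ y := by
      rintro rfl
      exact hay (h1.1.2 (Equiv.swap_apply_right _ _))
    rw [Equiv.swap_apply_of_ne_of_ne hbx hby] at h
    exact Or.inr ⟨h, hax, hay, hbx, hby⟩

theorem isCore_swap {n m : ℕ} {w : Equiv.Perm (Fin n)} {x y z : Fin n}
    (hyx : IsArc m w y x) : IsCore m (w * Equiv.swap x y) z ↔ IsCore m w z := by
  by_cases hx : z = x
  · subst hx
    simp only [IsCore, IsArc, Equiv.Perm.mul_apply, Equiv.swap_apply_left] at *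
    omega
  by_cases hy : z = y
  · subst hy
    simp only [IsCore, IsArc, Equiv.Perm.mul_apply, Equiv.swap_apply_right] at *
    omega
  simp only [IsCore, Equiv.Perm.mul_apply, Equiv.swap_apply_of_ne_of_ne hx hy]

/-! ### Edges and rank of the weak order -/

namespace Clan

variable {p q : ℕ}

theorem star_eq (γ : Clan p q) {x y : Fin (p + q)} (hxy : y.val = x.val + 1) :
    γ.star y.val = if h : γ.OppFixed x y then some (γ.matchFixed x y h)
      else if γ.perm x = y ∨ (γ.perm x = x ∧ γ.perm y = y) then none
      else some (γ.conj (Equiv.swap x y)) := by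
  have hx : (⟨y.val - 1, by omega⟩ : Fin (p + q)) = x := by ext; simp [hxy]
  have hy : 1 ≤ y.val ∧ y.val < p + q := ⟨by omega, y.isLt⟩
  rw [star, dif_pos hy, adjSwap_eq hxy]
  simp only [hx]

theorem OppFixed.symm {γ : Clan p q} {x y : Fin (p + q)} (h : γ.OppFixed x y) :
    γ.OppFixed y x := by
  unfold OppFixed at *
  tauto

theorem perm_inv (γ : Clan p q) : γ.perm⁻¹ = γ.perm := by
  rw [inv_eq_iff_mul_eq_one]
  exact Equiv.ext γ.perm_perm

theorem conj_conj_swap (γ : Clan p q) (x y : Fin (p + q)) :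
    (γ.conj (Equiv.swap x y)).conj (Equiv.swap x y) = γ := by
  ext z <;> simp [conj]

theorem permLength_matchFixed (γ : Clan p q) {x y : Fin (p + q)} (hxy : y.val = x.val + 1)
    (h : γ.OppFixed x y) : permLength (γ.matchFixed x y h).perm = permLength γ.perm + 1 := by
  obtain ⟨hx, hy, -⟩ := γ.oppFixed_fixed h
  refine permLength_swap_mul _ hxy ?_
  rw [perm_inv, hx, hy, Fin.lt_def]
  omega

/-- The right and the left multiplication each add an inversion. If `x` and `y` were both fixed, the
second would undo the first; `hf` rules this out. -/
theorem permLength_conj (γ : Clan p q) {x y : Fin (p + q)} (hxy : y.val = x.val + 1)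
    (hlt : γ.perm x < γ.perm y) (hf : ¬ (γ.perm x = x ∧ γ.perm y = y)) :
    permLength (γ.conj (Equiv.swap x y)).perm = permLength γ.perm + 2 := by
  have h1 := permLength_mul_swap γ.perm hxy hlt
  have h2 := permLength_swap_mul (γ.perm * Equiv.swap x y) hxy (by
    rw [mul_inv_rev, perm_inv, Equiv.swap_inv, Equiv.Perm.mul_apply, Equiv.Perm.mul_apply,
      swap_lt_swap hxy]
    exact Or.inl ⟨hlt, hf⟩)
  rw [h1, ← mul_assoc] at h2
  simpa [conj] using h2

theorem permLength_conj_of_gt (γ : Clan p q) {x y : Fin (p + q)} (hxy : y.val = x.val + 1)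
    (hlt : γ.perm y < γ.perm x) (hf : γ.perm x ≠ y) :
    permLength (γ.conj (Equiv.swap x y)).perm + 2 = permLength γ.perm := by
  have h1 := permLength_mul_swap_of_gt γ.perm hxy hlt
  have h2 := permLength_swap_mul_of_gt (γ.perm * Equiv.swap x y) hxy (by
    rw [mul_inv_rev, perm_inv, Equiv.swap_inv, Equiv.Perm.mul_apply, Equiv.Perm.mul_apply,
      swap_lt_swap hxy]
    exact Or.inl ⟨hlt, fun h => hf h.2⟩)
  rw [← mul_assoc] at h2
  have h3 : permLength (γ.conj (Equiv.swap x y)).perm + 1 =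
    permLength (γ.perm * Equiv.swap x y) := by simpa [conj] using h2
  omega

/-- The edges of the weak order. -/
theorem star_eq_some {γ δ : Clan p q} {x y : Fin (p + q)} (hxy : y.val = x.val + 1)
    (h : γ.star y.val = some δ) (hl : permLength γ.perm < permLength δ.perm) :
    (∃ h : γ.OppFixed x y, δ = γ.matchFixed x y h) ∨
      (δ = γ.conj (Equiv.swap x y) ∧ γ.perm x < γ.perm y ∧ γ.perm x ≠ y ∧
        ¬ (γ.perm x = x ∧ γ.perm y = y)) := by
  rw [star_eq _ hxy] at h
  split_ifs at h with h1 h2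
  · exact Or.inl ⟨h1, (Option.some.inj h).symm⟩
  · obtain rfl := Option.some.inj h
    push Not at h2
    refine Or.inr ⟨rfl, ?_, h2.1, fun hh => h2.2 hh.1 hh.2⟩
    by_contra hcon
    have hne : γ.perm y ≠ γ.perm x := fun e => by
      have := γ.perm.injective e
      subst this
      omega
    have := permLength_conj_of_gt γ hxy (lt_of_le_of_ne (not_lt.1 hcon) hne) h2.1
    omega

theorem card_matchFixed (γ : Clan p q) {x y : Fin (p + q)} (h : γ.OppFixed x y) :
    (γ.matchFixed x y h).plus.card + 1 = γ.plus.card := by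
  obtain ⟨z, hz, he⟩ : ∃ z ∈ γ.plus, γ.plus \ {x, y} = γ.plus.erase z := by
    have hd := Finset.disjoint_left.1 γ.disj
    rcases h with ⟨h1, h2⟩ | ⟨h1, h2⟩
    · refine ⟨x, h1, ?_⟩
      ext z
      simp only [Finset.mem_sdiff, Finset.mem_insert, Finset.mem_singleton, Finset.mem_erase]
      grind
    · refine ⟨y, h2, ?_⟩
      ext z
      simp only [Finset.mem_sdiff, Finset.mem_insert, Finset.mem_singleton, Finset.mem_erase]
      grind
  change (γ.plus \ {x, y}).card + 1 = _
  rw [he, Finset.card_erase_add_one hz]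

/-- A rank function of the weak order. -/
theorem rank_star {γ δ : Clan p q} {i : ℕ}
    (h : γ.star i = some δ) (hl : permLength γ.perm < permLength δ.perm) :
    permLength δ.perm + γ.plus.card = permLength γ.perm + δ.plus.card + 2 := by
  have hi : 1 ≤ i ∧ i < p + q := by
    by_contra hcon
    rw [star, dif_neg hcon] at h
    cases h
  obtain ⟨x, y, hxy, rfl⟩ := exists_adjacent hi
  -- Matching adds 1 to the length and removes one plus sign; conjugation adds 2 and keeps the
  -- number of plus signs. Either way the length minus the number of plus signs grows by 2.
  rcases star_eq_some hxy h hl with ⟨h1, rfl⟩ | ⟨rfl, h1, -, h2⟩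
  · have := permLength_matchFixed γ hxy h1
    have := card_matchFixed γ h1
    omega
  · have := permLength_conj γ hxy h1 h2
    have h3 : (γ.conj (Equiv.swap x y)).plus.card = γ.plus.card := Finset.card_map _
    omega

theorem WeakLT.rank_le {δ γ : Clan p q} (h : WeakLT δ γ) :
    permLength γ.perm < permLength δ.perm ∧
      permLength γ.perm + δ.plus.card + 2 ≤ permLength δ.perm + γ.plus.card := by
  unfold WeakLT at h
  induction h with
  | single h =>
    obtain ⟨i, h1, h2⟩ := h
    have := rank_star h1 h2
    omega
  | tail _ h ih =>
    obtain ⟨i, h1, h2⟩ := h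
    have := rank_star h1 h2
    omega

/-- The edges of the weak order are covering relations. -/
theorem weakCovBy_of_star {γ δ : Clan p q} {i : ℕ}
    (h : γ.star i = some δ) (hl : permLength γ.perm < permLength δ.perm) : WeakCovBy δ γ := by
  refine ⟨Relation.TransGen.single ⟨i, h, hl⟩, fun ε ⟨h1, h2⟩ => ?_⟩
  -- A clan strictly between would force a rank difference of at least 4.
  have := rank_star h hl
  have := h1.rank_le
  have := h2.rank_le
  omega

/-! ### Compatibility and the description of atoms -/

/-- The unmarked arcs of `w` are matched in `γ`, the ends of its marked arcs have opposite signs,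
and all other points have the sign of `p - q`. -/
structure Compatible (w : Equiv.Perm (Fin (p + q))) (γ : Clan p q) : Prop where
  plus : q < p → ∀ x, IsCore (min p q) w x → x ∈ γ.plus
  minus : p < q → ∀ x, IsCore (min p q) w x → x ∈ γ.minus
  unmarked : ∀ a b, IsArc (min p q) w a b → a < b → γ.perm a = b
  marked : ∀ a b, IsArc (min p q) w a b → b < a → γ.OppFixed a b

theorem Compatible.matches {w : Equiv.Perm (Fin (p + q))} {γ : Clan p q} (h : Compatible w γ) :
    Matches (min p q) w γ.perm where
  core x hx := by
    rw [γ.fixed_iff]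
    rcases lt_trichotomy p q with h1 | h1 | h1
    · exact Or.inr (h.minus h1 x hx)
    · unfold IsCore at hx
      omega
    · exact Or.inl (h.plus h1 x hx)
  unmarked a b hab hlt := by
    have := h.unmarked a b hab hlt
    exact ⟨this, by rw [← this, γ.perm_perm]⟩
  marked a b hab hlt := by
    have := γ.oppFixed_fixed (h.marked a b hab hlt)
    exact ⟨this.1, this.2.1⟩

theorem two_mul_min_le (p q : ℕ) : 2 * min p q ≤ p + q := by omega

theorem oppFixed_conj {γ : Clan p q} {s : Equiv.Perm (Fin (p + q))} {a b : Fin (p + q)} :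
    (γ.conj s).OppFixed (s a) (s b) ↔ γ.OppFixed a b := by
  simp [OppFixed, conj]

/-- Swapping adjacent positions reverses the direction of an arc only if they are its two ends,
which `h1` and `h2` exclude. -/
theorem Compatible.conj {w : Equiv.Perm (Fin (p + q))} {γ : Clan p q} (h : Compatible w γ)
    {x y : Fin (p + q)} (hxy : y.val = x.val + 1) (h1 : ¬ IsArc (min p q) w x y)
    (h2 : ¬ IsArc (min p q) w y x) :
    Compatible (w * Equiv.swap x y) (γ.conj (Equiv.swap x y)) where
  plus hpq z hz := by
    have := h.plus hpq (Equiv.swap x y z) hz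
    simpa [Clan.conj] using this
  minus hpq z hz := by
    have := h.minus hpq (Equiv.swap x y z) hz
    simpa [Clan.conj] using this
  unmarked a b := by
    obtain ⟨a, rfl⟩ := (Equiv.swap x y).surjective a
    obtain ⟨b, rfl⟩ := (Equiv.swap x y).surjective b
    intro hab hlt
    rw [isArc_mul_swap] at hab
    rw [swap_lt_swap hxy] at hlt
    rcases hlt with hlt | ⟨rfl, rfl⟩
    · simp [Clan.conj, h.unmarked a b hab hlt.1]
    · exact absurd hab h2
  marked a b := by
    obtain ⟨a, rfl⟩ := (Equiv.swap x y).surjective a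
    obtain ⟨b, rfl⟩ := (Equiv.swap x y).surjective b
    intro hab hlt
    rw [isArc_mul_swap] at hab
    rw [swap_lt_swap hxy] at hlt
    rcases hlt with hlt | ⟨rfl, rfl⟩
    · exact oppFixed_conj.2 (h.marked a b hab hlt.1)
    · exact absurd hab h1

/-- The swap reverses the single marked arc from `y` to `x`, making it unmarked, just when its ends
become matched; `Compatible.of_matchFixed` is the way back. -/
theorem Compatible.matchFixed {w : Equiv.Perm (Fin (p + q))} {γ : Clan p q} (hc : Compatible w γ)
    {x y : Fin (p + q)} (hlt : x < y) (hyx : IsArc (min p q) w y x) (h : γ.OppFixed x y) :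
    Compatible (w * Equiv.swap x y) (γ.matchFixed x y h) where
  plus hpq z hz := by
    rw [isCore_swap hyx] at hz
    have := hyx.ne_of_isCore hz
    simp [Clan.matchFixed, hc.plus hpq z hz, this]
  minus hpq z hz := by
    rw [isCore_swap hyx] at hz
    have := hyx.ne_of_isCore hz
    simp [Clan.matchFixed, hc.minus hpq z hz, this]
  unmarked a b hab hl := by
    rcases isArc_swap_cases (two_mul_min_le p q) hyx hab with ⟨rfl, rfl⟩ | ⟨hab, h1, h2, h3, h4⟩
    · simp [Clan.matchFixed, (γ.oppFixed_fixed h).1]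
    · simp [Clan.matchFixed, hc.unmarked a b hab hl, Equiv.swap_apply_of_ne_of_ne h3 h4]
  marked a b hab hl := by
    rcases isArc_swap_cases (two_mul_min_le p q) hyx hab with ⟨rfl, rfl⟩ | ⟨hab, h1, h2, h3, h4⟩
    · exact absurd hl hlt.not_gt
    · have := hc.marked a b hab hl
      simpa [Clan.matchFixed, OppFixed, h1, h2, h3, h4] using this

theorem Compatible.of_matchFixed {w : Equiv.Perm (Fin (p + q))} {γ : Clan p q}
    {x y : Fin (p + q)} (hlt : x < y) (hyx : IsArc (min p q) w y x) (h : γ.OppFixed x y)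
    (hc : Compatible (w * Equiv.swap x y) (γ.matchFixed x y h)) : Compatible w γ where
  plus hpq z hz := (Finset.mem_sdiff.1 (hc.plus hpq z ((isCore_swap hyx).2 hz))).1
  minus hpq z hz := (Finset.mem_sdiff.1 (hc.minus hpq z ((isCore_swap hyx).2 hz))).1
  unmarked a b hab hl := by
    have h1 := IsArc.eq_iff (two_mul_min_le p q) hab hyx
    by_cases hay : a = y
    · obtain rfl := hay
      obtain rfl := h1.1.1 rfl
      exact absurd hl hlt.not_gt
    have hbx : b ≠ x := fun e => hay (h1.1.2 e)
    have := hc.unmarked a b (by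
      rw [← isArc_mul_swap _ x y, mul_assoc, Equiv.swap_mul_self, mul_one,
        Equiv.swap_apply_of_ne_of_ne h1.2.1 hay, Equiv.swap_apply_of_ne_of_ne hbx h1.2.2]
      exact hab) hl
    have h2 : Equiv.swap x y (γ.perm a) = b := this
    rw [← Equiv.swap_apply_of_ne_of_ne hbx h1.2.2] at h2
    exact (Equiv.swap x y).injective h2
  marked a b hab hl := by
    have h1 := IsArc.eq_iff (two_mul_min_le p q) hab hyx
    by_cases hay : a = y
    · obtain rfl := hay
      obtain rfl := h1.1.1 rfl
      exact h.symm
    have hbx : b ≠ x := fun e => hay (h1.1.2 e)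
    have := hc.marked a b (by
      rw [← isArc_mul_swap _ x y, mul_assoc, Equiv.swap_mul_self, mul_one,
        Equiv.swap_apply_of_ne_of_ne h1.2.1 hay, Equiv.swap_apply_of_ne_of_ne hbx h1.2.2]
      exact hab) hl
    simpa [Clan.matchFixed, OppFixed, h1.2.1, h1.2.2, hay, hbx] using this

/-- Compatibility passes down along descents of admissible permutations. -/
theorem Compatible.exists_star {w : Equiv.Perm (Fin (p + q))} {γ : Clan p q}
    (hw : IsAdmissible (min p q) w) (hc : Compatible w γ) {x y : Fin (p + q)}
    (hxy : y.val = x.val + 1) (hd : w y < w x) :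
    ∃ δ, γ.star y.val = some δ ∧ permLength γ.perm < permLength δ.perm ∧
      Compatible (w * Equiv.swap x y) δ := by
  have hlt : x < y := by rw [Fin.lt_def]; omega
  -- An arc starts at its smaller label, so it cannot start at the left end of a descent.
  have hnxy : ¬ IsArc (min p q) w x y := by
    intro h
    have := two_mul_min_le p q
    unfold IsArc at h
    rw [Fin.lt_def] at hd
    omega
  by_cases hyx : IsArc (min p q) w y x
  · have h := (hc.marked y x hyx hlt).symm
    refine ⟨γ.matchFixed x y h, by rw [star_eq _ hxy, dif_pos h], ?_, hc.matchFixed hlt hyx h⟩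
    rw [permLength_matchFixed γ hxy h]
    omega
  · obtain ⟨h1, h2⟩ := hw.matches_lt (two_mul_min_le p q) hc.matches hxy hd hyx
    refine ⟨γ.conj (Equiv.swap x y), ?_, ?_, hc.conj hxy hnxy hyx⟩
    · rw [star_eq _ hxy, dif_neg, if_neg]
      · rintro (h3 | h3)
        · have h4 := γ.perm_perm x
          rw [h3] at h4
          rw [h3, h4] at h1
          exact h1.not_gt hlt
        · exact h2 h3
      · intro h
        have := γ.oppFixed_fixed h
        exact h2 ⟨this.1, this.2.1⟩
    · rw [permLength_conj γ hxy h1 h2]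
      omega

/-- Compatibility passes up along the edges of the weak order. -/
theorem Compatible.of_star {v : Equiv.Perm (Fin (p + q))} {γ δ : Clan p q}
    (hv : IsAdmissible (min p q) v) (hc : Compatible v δ) {x y : Fin (p + q)}
    (hxy : y.val = x.val + 1) (h : γ.star y.val = some δ)
    (hl : permLength γ.perm < permLength δ.perm) :
    IsAdmissible (min p q) (v * Equiv.swap x y) ∧ Compatible (v * Equiv.swap x y) γ := by
  have hlt : x < y := by rw [Fin.lt_def]; omega
  rcases star_eq_some hxy h hl with ⟨h1, rfl⟩ | ⟨rfl, h1, h2, h3⟩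
  · obtain ⟨hx, hy, -⟩ := γ.oppFixed_fixed h1
    have hx' : (γ.matchFixed x y h1).perm x = y := by simp [Clan.matchFixed, hx]
    have hy' : (γ.matchFixed x y h1).perm y = x := by simp [Clan.matchFixed, hy]
    refine ⟨hv.mul_swap_of_matches hc.matches hxy (by rwa [hx', hy']), ?_⟩
    -- Core points and ends of marked arcs are fixed, so the matched pair `x`, `y` is an unmarked
    -- arc of `v`, which starts at its left end.
    have hxyv : IsArc (min p q) v x y := by
      rcases isCore_or_isArc (min p q) v x with hh | ⟨a, ha⟩ | ⟨a, ha⟩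
      · exact absurd ((hc.matches.core x hh).symm.trans hx') hlt.ne
      · rcases lt_trichotomy x a with h4 | h4 | h4
        · rwa [← hx', (hc.matches.unmarked x a ha h4).1]
        · subst h4
          exact absurd rfl (IsArc.eq_iff (two_mul_min_le p q) ha ha).2.1
        · exact absurd ((hc.matches.marked x a ha h4).1.symm.trans hx') hlt.ne
      · rcases lt_trichotomy a x with h4 | h4 | h4
        · have h5 := (hc.matches.unmarked a x ha h4).2
          rw [hx'] at h5
          exact absurd (h5 ▸ h4) hlt.not_gt
        · subst h4
          exact absurd rfl (IsArc.eq_iff (two_mul_min_le p q) ha ha).2.1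
        · exact absurd ((hc.matches.marked a x ha h4).2.symm.trans hx') hlt.ne
    refine Compatible.of_matchFixed hlt ?_ h1 (by
      rwa [mul_assoc, Equiv.swap_mul_self, mul_one])
    simpa using (isArc_mul_swap v x y x y).2 hxyv
  · have hx' : (γ.conj (Equiv.swap x y)).perm x = Equiv.swap x y (γ.perm y) := by simp [Clan.conj]
    have hy' : (γ.conj (Equiv.swap x y)).perm y = Equiv.swap x y (γ.perm x) := by simp [Clan.conj]
    have hd : (γ.conj (Equiv.swap x y)).perm y < (γ.conj (Equiv.swap x y)).perm x := by
      rw [hx', hy', swap_lt_swap hxy]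
      exact Or.inl ⟨h1, h3⟩
    refine ⟨hv.mul_swap_of_matches hc.matches hxy hd, ?_⟩
    -- An unmarked arc on `x`, `y` would make `γ` match them, against `h2`; a marked one would make
    -- both fixed, against the descent `hd`.
    have := hc.conj hxy (fun h4 => ?_) (fun h4 => ?_)
    · rwa [conj_conj_swap] at this
    · have h5 := (hc.matches.unmarked x y h4 hlt).1
      rw [hx', Equiv.swap_apply_eq_iff, Equiv.swap_apply_right] at h5
      exact h2 (by rw [← h5, γ.perm_perm])
    · have h5 := hc.matches.marked y x h4 hlt
      rw [h5.1, h5.2] at hd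
      exact hd.not_gt hlt

theorem compatible_one_base : Compatible 1 (base p q) where
  plus hpq x hx := by
    simp only [IsCore, Equiv.Perm.one_apply] at hx
    simp only [base, if_pos hpq, baseFixed, Finset.mem_filter, Finset.mem_univ, true_and]
    omega
  minus hpq x hx := by
    simp only [IsCore, Equiv.Perm.one_apply] at hx
    simp only [base, if_pos hpq, baseFixed, Finset.mem_filter, Finset.mem_univ, true_and]
    omega
  unmarked a b hab hl := by
    simp only [IsArc, Equiv.Perm.one_apply] at hab
    change baseFun p q a = b
    rw [baseFun, if_pos (Or.inl hab.1)]
    ext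
    rw [Fin.val_rev]
    omega
  marked a b hab hl := by
    have := two_mul_min_le p q
    simp only [IsArc, Equiv.Perm.one_apply] at hab
    rw [Fin.lt_def] at hl
    omega

/-- All arcs of the identity are unmarked, so compatibility prescribes the whole matching, and every
fixed point is a core point whose sign is prescribed too. -/
theorem Compatible.eq_base {γ : Clan p q} (h : Compatible 1 γ) : γ = base p q := by
  have hm := two_mul_min_le p q
  have hperm : γ.perm = (base p q).perm := by
    ext1 x
    rcases isCore_or_isArc (min p q) 1 x with hx | ⟨a, ha⟩ | ⟨a, ha⟩
    · rw [h.matches.core x hx, compatible_one_base.matches.core x hx]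
    · have hl : x < a := by
        simp only [IsArc, Equiv.Perm.one_apply] at ha
        rw [Fin.lt_def]
        omega
      rw [(h.matches.unmarked x a ha hl).1, (compatible_one_base.matches.unmarked x a ha hl).1]
    · have hl : a < x := by
        simp only [IsArc, Equiv.Perm.one_apply] at ha
        rw [Fin.lt_def]
        omega
      rw [(h.matches.unmarked a x ha hl).2, (compatible_one_base.matches.unmarked a x ha hl).2]
  have hcore : ∀ x, γ.perm x = x → IsCore (min p q) 1 x := by
    intro x hx
    rcases isCore_or_isArc (min p q) 1 x with hh | ⟨a, ha⟩ | ⟨a, ha⟩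
    · exact hh
    · have hl : x < a := by
        simp only [IsArc, Equiv.Perm.one_apply] at ha
        rw [Fin.lt_def]
        omega
      exact absurd (hx.symm.trans (h.matches.unmarked x a ha hl).1) hl.ne
    · have hl : a < x := by
        simp only [IsArc, Equiv.Perm.one_apply] at ha
        rw [Fin.lt_def]
        omega
      exact absurd (hx.symm.trans (h.matches.unmarked a x ha hl).2) hl.ne'
  have hb := compatible_one_base (p := p) (q := q)
  have signs : ∀ x, (x ∈ γ.plus ↔ x ∈ (base p q).plus) ∧ (x ∈ γ.minus ↔ x ∈ (base p q).minus) := by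
    intro x
    have f1 := γ.fixed_iff x
    have f2 := (base p q).fixed_iff x
    rw [← hperm] at f2
    have d1 : x ∈ γ.plus → x ∉ γ.minus := fun h => Finset.disjoint_left.1 γ.disj h
    have d2 : x ∈ (base p q).plus → x ∉ (base p q).minus :=
      fun h => Finset.disjoint_left.1 (base p q).disj h
    by_cases hx : γ.perm x = x
    · have hk := hcore x hx
      rcases lt_trichotomy p q with h1 | h1 | h1
      · have := h.minus h1 x hk
        have := hb.minus h1 x hk
        tauto
      · simp only [IsCore] at hk
        omega
      · have := h.plus h1 x hk
        have := hb.plus h1 x hk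
        tauto
    · tauto
  exact Clan.ext hperm (Finset.ext fun x => (signs x).1) (Finset.ext fun x => (signs x).2)

theorem IsReducedWord.compatible {γ : Clan p q} {a : List ℕ} (h : IsReducedWord γ a) :
    IsAdmissible (min p q) (wordProd (p + q) a) ∧ Compatible (wordProd (p + q) a) γ := by
  induction h with
  | nil => exact ⟨isAdmissible_one _, compatible_one_base⟩
  | @snoc δ γ a i _ hcov hi ih =>
    have hi' : 1 ≤ i ∧ i < p + q := by
      by_contra hcon
      rw [star, dif_neg hcon] at hi
      cases hi
    obtain ⟨x, y, hxy, rfl⟩ := exists_adjacent hi'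
    rw [wordProd_concat, adjSwap_eq hxy]
    exact ih.2.of_star ih.1 hxy hi hcov.1.rank_le.1

theorem Compatible.isReducedWord {w : Equiv.Perm (Fin (p + q))} {γ : Clan p q}
    (hw : IsAdmissible (min p q) w) (hc : Compatible w γ) {a : List ℕ}
    (ha : a ∈ permReducedWords w) : IsReducedWord γ a := by
  induction a using List.reverseRecOn generalizing w γ with
  | nil =>
    have h1 : w = 1 := ha.2.1.symm
    subst h1
    rw [hc.eq_base]
    exact IsReducedWord.nil
  | append_singleton a i ih =>
    obtain ⟨x, y, hxy, rfl, hd, ha'⟩ := permReducedWords_concat ha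
    obtain ⟨δ, h1, h2, h3⟩ := hc.exists_star hw hxy hd
    exact IsReducedWord.snoc (ih (hw.mul_swap_of_gt (two_mul_min_le p q) hxy hd) h3 ha')
      (weakCovBy_of_star h1 h2) h1

/-- The explicit description of the atoms of a clan. -/
theorem mem_atoms_iff {w : Equiv.Perm (Fin (p + q))} {γ : Clan p q} :
    w ∈ γ.atoms ↔ IsAdmissible (min p q) w ∧ Compatible w γ := by
  constructor
  · intro h
    obtain ⟨a, ha⟩ := permReducedWords_nonempty w
    -- One reduced word is enough, since both conditions depend only on its product.
    have := IsReducedWord.compatible (h ha)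
    rwa [ha.2.1] at this
  · rintro ⟨h1, h2⟩ a ha
    exact h2.isReducedWord h1 ha

end Clan

/-! ### The exchange of labels by s_k s_{n-k} -/

theorem perm_apply_inv {n : ℕ} (w : Equiv.Perm (Fin n)) (x : Fin n) : w (w⁻¹ x) = x := by
  simp

theorem isCore_congr {n m : ℕ} {v w : Equiv.Perm (Fin n)}
    (h : ∀ a b, IsArc m v a b ↔ IsArc m w a b) (x : Fin n) : IsCore m v x ↔ IsCore m w x := by
  constructor
  · intro hx
    rcases isCore_or_isArc m w x with h1 | ⟨a, ha⟩ | ⟨a, ha⟩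
    · exact h1
    · exact absurd rfl (((h _ _).2 ha).ne_of_isCore hx).1
    · exact absurd rfl (((h _ _).2 ha).ne_of_isCore hx).2
  · intro hx
    rcases isCore_or_isArc m v x with h1 | ⟨a, ha⟩ | ⟨a, ha⟩
    · exact h1
    · exact absurd rfl (((h _ _).1 ha).ne_of_isCore hx).1
    · exact absurd rfl (((h _ _).1 ha).ne_of_isCore hx).2

theorem low_congr {n m : ℕ} {v w : Equiv.Perm (Fin n)}
    (h : ∀ a b, IsArc m v a b ↔ IsArc m w a b) (x : Fin n) (hx : (v x).val < m) :
    (w x).val < m := by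
  have := (v x).isLt
  have h1 : IsArc m v x (v⁻¹ (v x).rev) := ⟨hx, by simp; omega⟩
  exact ((h _ _).1 h1).1

/-- The product `s_k s_{n-k}` as an exchange of labels. -/
theorem exists_exchange {n m k : ℕ} (hm : 2 * m ≤ n) (h1 : 1 ≤ k) (hk : k < m) :
    ∃ x₀ x₁ z₀ z₁ : Fin n, x₁.val = x₀.val + 1 ∧ z₁.val = z₀.val + 1 ∧ x₁.val = k ∧
      z₁.val + k = n ∧ adjSwap n k = Equiv.swap x₀ x₁ ∧ adjSwap n (n - k) = Equiv.swap z₀ z₁ := by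
  obtain ⟨x₀, x₁, hx, hxk⟩ := exists_adjacent (n := n) (k := k) ⟨h1, by omega⟩
  obtain ⟨z₀, z₁, hz, hzk⟩ := exists_adjacent (n := n) (k := n - k) ⟨by omega, by omega⟩
  exact ⟨x₀, x₁, z₀, z₁, hx, hz, hxk, by omega, by rw [← hxk, adjSwap_eq hx],
    by rw [← hzk, adjSwap_eq hz]⟩

/-- Labels are zero-based here. The bound `hkn` says k < n-k-1, so the two transpositions are
disjoint. -/
theorem exchange_val {n k : ℕ} {x₀ x₁ z₀ z₁ : Fin n} (hx : x₁.val = x₀.val + 1)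
    (hz : z₁.val = z₀.val + 1) (hxk : x₁.val = k) (hzk : z₁.val + k = n) (hkn : 2 * k < n - 1)
    (c : Fin n) :
    ((Equiv.swap x₀ x₁ * Equiv.swap z₀ z₁) c).val =
      if c.val + 1 = k then k else if c.val = k then k - 1 else
      if c.val + k + 1 = n then n - k else if c.val + k = n then n - k - 1 else c.val := by
  rw [Equiv.Perm.mul_apply, Equiv.swap_apply_def z₀, Equiv.swap_apply_def x₀]
  simp only [Fin.ext_iff, apply_ite Fin.val]
  grind

/-- The product s_k s_{n-k} commutes with the reversal of labels and, as k < m, preserves the set of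
the m smallest ones. -/
theorem isArc_exchange {n m k : ℕ} (hm : 2 * m ≤ n) (h1 : 1 ≤ k) (hk : k < m)
    (u : Equiv.Perm (Fin n)) (a b : Fin n) :
    IsArc m (adjSwap n k * adjSwap n (n - k) * u) a b ↔ IsArc m u a b := by
  obtain ⟨x₀, x₁, z₀, z₁, hx, hz, hxk, hzk, e1, e2⟩ := exists_exchange hm h1 hk
  rw [e1, e2]
  unfold IsArc
  rw [Equiv.Perm.mul_apply _ u a, Equiv.Perm.mul_apply _ u b,
    exchange_val hx hz hxk hzk (by omega), exchange_val hx hz hxk hzk (by omega)]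
  split_ifs <;> omega

/-- Each of the two disjoint transpositions changes the length by one; the length is kept iff the
changes have opposite signs. -/
theorem permLength_exchange_iff {n : ℕ} {x₀ x₁ z₀ z₁ : Fin n} (hx : x₁.val = x₀.val + 1)
    (hz : z₁.val = z₀.val + 1) (hxz : x₁.val < z₀.val) (u : Equiv.Perm (Fin n)) :
    permLength (Equiv.swap x₀ x₁ * Equiv.swap z₀ z₁ * u) = permLength u ↔
      (u⁻¹ x₀ < u⁻¹ x₁ ↔ u⁻¹ z₁ < u⁻¹ z₀) := by
  have hne : u⁻¹ x₀ ≠ u⁻¹ x₁ := fun e => by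
    have := (u⁻¹).injective e
    subst this
    omega
  have hne' : u⁻¹ z₀ ≠ u⁻¹ z₁ := fun e => by
    have := (u⁻¹).injective e
    subst this
    omega
  have f0 : (Equiv.swap z₀ z₁ * u)⁻¹ x₀ = u⁻¹ x₀ := by
    rw [mul_inv_rev, Equiv.swap_inv, Equiv.Perm.mul_apply, Equiv.swap_apply_of_ne_of_ne] <;>
    · intro e
      subst e
      omega
  have f1 : (Equiv.swap z₀ z₁ * u)⁻¹ x₁ = u⁻¹ x₁ := by
    rw [mul_inv_rev, Equiv.swap_inv, Equiv.Perm.mul_apply, Equiv.swap_apply_of_ne_of_ne] <;>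
    · intro e
      subst e
      omega
  rw [mul_assoc]
  rcases lt_or_gt_of_ne hne with h1 | h1 <;> rcases lt_or_gt_of_ne hne' with h2 | h2
  · have := permLength_swap_mul u hz h2
    have := permLength_swap_mul (Equiv.swap z₀ z₁ * u) hx (by rwa [f0, f1])
    simp only [h1, h2.not_gt, iff_false, not_true]
    omega
  · have := permLength_swap_mul_of_gt u hz h2
    have := permLength_swap_mul (Equiv.swap z₀ z₁ * u) hx (by rwa [f0, f1])
    simp only [h1, h2, iff_true]
    omega
  · have := permLength_swap_mul u hz h2
    have := permLength_swap_mul_of_gt (Equiv.swap z₀ z₁ * u) hx (by rwa [f0, f1])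
    simp only [h1.not_gt, h2.not_gt, iff_true]
    omega
  · have := permLength_swap_mul_of_gt u hz h2
    have := permLength_swap_mul_of_gt (Equiv.swap z₀ z₁ * u) hx (by rwa [f0, f1])
    simp only [h1.not_gt, h2, iff_true, iff_false]
    omega

theorem IsAdmissible.exchange_of_permLength_eq {n m k : ℕ} (hm : 2 * m ≤ n) (h1 : 1 ≤ k)
    (hk : k < m) {u : Equiv.Perm (Fin n)} (hu : IsAdmissible m u)
    (hl : permLength (adjSwap n k * adjSwap n (n - k) * u) = permLength u) :
    IsAdmissible m (adjSwap n k * adjSwap n (n - k) * u) := by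
  have harc := isArc_exchange hm h1 hk u
  have hcore := isCore_congr harc
  obtain ⟨x₀, x₁, z₀, z₁, hx, hz, hxk, hzk, e1, e2⟩ := exists_exchange hm h1 hk
  rw [e1, e2] at hl harc hcore ⊢
  rw [permLength_exchange_iff hx hz (by omega)] at hl
  -- The two arcs carry the labels k, n-k+1 and k+1, n-k; for them equality of lengths is exactly
  -- the hypothesis that no order is forced.
  refine hu.exchange harc (fun x hc => ?_) (a := u⁻¹ x₀) (b := u⁻¹ z₁) (c := u⁻¹ x₁)
    (d := u⁻¹ z₀) ?_ ?_ hl ?_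
  · have hc' := (hcore x).1 hc
    refine ⟨hc', Fin.ext ?_⟩
    rw [Equiv.Perm.mul_apply _ u x, exchange_val hx hz hxk hzk (by omega)]
    unfold IsCore at hc'
    split_ifs <;> omega
  · simp only [IsArc, perm_apply_inv]
    omega
  · simp only [IsArc, perm_apply_inv]
    omega
  · intro e f g h hef hgh hlt
    unfold IsArc at hef hgh
    rw [Fin.lt_def] at hlt
    by_cases hc : (u e).val = x₀.val ∧ (u g).val = x₁.val
    · right
      rw [← Fin.ext_iff, ← Fin.ext_iff] at hc
      rw [← hc.1, ← hc.2]
      simp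
    · left
      rw [Fin.lt_def, Equiv.Perm.mul_apply _ u e, Equiv.Perm.mul_apply _ u g,
        exchange_val hx hz hxk hzk (by omega), exchange_val hx hz hxk hzk (by omega)]
      split_ifs <;> omega

/-- Distinct admissible permutations with the same arcs have two arcs with consecutive labels
which appear in opposite orders. -/
theorem exists_opposite_labels {n m : ℕ} {v w : Equiv.Perm (Fin n)}
    (hv : IsAdmissible m v) (hw : IsAdmissible m w) (harc : ∀ a b, IsArc m v a b ↔ IsArc m w a b)
    (hne : w * v⁻¹ ≠ 1) :
    ∃ k, 1 ≤ k ∧ k < m ∧ ∀ x₀ x₁ : Fin n, x₁.val = x₀.val + 1 → x₁.val = k →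
      w (v⁻¹ x₁) < w (v⁻¹ x₀) := by
  obtain ⟨x, y, hxy, hd⟩ := exists_descent hne
  rw [Equiv.Perm.mul_apply, Equiv.Perm.mul_apply] at hd
  by_cases h1 : y.val < m
  · refine ⟨y.val, by omega, h1, fun x₀ x₁ h2 h3 => ?_⟩
    obtain rfl : x₁ = y := Fin.ext h3
    obtain rfl : x₀ = x := Fin.ext (by omega)
    exact hd
  by_cases h2 : n ≤ x.val + m
  · have hyn := y.isLt
    -- A descent among the large labels is reflected to the small labels at the other ends of the
    -- same arcs.
    refine ⟨n - y.val, by omega, by omega, fun x₀ x₁ h3 h4 => ?_⟩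
    have a1 : IsArc m w (v⁻¹ x₀) (v⁻¹ y) := by
      rw [← harc]
      simp only [IsArc, perm_apply_inv]
      omega
    have a2 : IsArc m w (v⁻¹ x₁) (v⁻¹ x) := by
      rw [← harc]
      simp only [IsArc, perm_apply_inv]
      omega
    unfold IsArc at a1 a2
    rw [Fin.lt_def] at hd ⊢
    omega
  -- No other descent exists: `w * v⁻¹` preserves the small, core and large labels, and is
  -- increasing on the core labels because both permutations are increasing on the common core.
  exfalso
  have hcore := isCore_congr harc
  have hlow := low_congr harc
  have hlow' := low_congr fun a b => (harc a b).symm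
  have kx : m ≤ x.val → IsCore m v (v⁻¹ x) := fun h => by
    simp only [IsCore, perm_apply_inv]
    omega
  have ky : y.val + m < n → IsCore m v (v⁻¹ y) := fun h => by
    simp only [IsCore, perm_apply_inv]
    omega
  rw [Fin.lt_def] at hd
  have l1 := hlow (v⁻¹ x)
  have l2 := hlow' (v⁻¹ y)
  rw [perm_apply_inv] at l1 l2
  by_cases h3 : x.val < m
  · have := l1 h3
    exact h1 (l2 (by omega))
  have cx := kx (by omega)
  have cx' := (hcore _).1 cx
  by_cases h4 : y.val + m < n
  · have cy := ky h4
    have cy' := (hcore _).1 cy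
    rcases lt_trichotomy (v⁻¹ x) (v⁻¹ y) with h5 | h5 | h5
    · have := hw.core_lt _ _ cx' cy' h5
      rw [Fin.lt_def] at this
      omega
    · rw [h5] at hd
      omega
    · have := hv.core_lt _ _ cy cx h5
      rw [perm_apply_inv, perm_apply_inv, Fin.lt_def] at this
      omega
  · unfold IsCore at cx'
    have h5 : ¬ IsCore m w (v⁻¹ y) := by
      rw [← hcore]
      simp only [IsCore, perm_apply_inv]
      omega
    unfold IsCore at h5
    have := l2
    omega

/-! ### Recovering the arcs from the compatible clans -/

namespace Clan

variable {p q : ℕ}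

theorem Compatible.congr {v w : Equiv.Perm (Fin (p + q))} {γ : Clan p q} (h : Compatible v γ)
    (harc : ∀ a b, IsArc (min p q) v a b ↔ IsArc (min p q) w a b) : Compatible w γ where
  plus hpq x hx := h.plus hpq x ((isCore_congr harc x).2 hx)
  minus hpq x hx := h.minus hpq x ((isCore_congr harc x).2 hx)
  unmarked a b hab := h.unmarked a b ((harc a b).2 hab)
  marked a b hab := h.marked a b ((harc a b).2 hab)

/-- The signs of the ends of a marked arc can be exchanged. -/
theorem Compatible.conj_marked {v : Equiv.Perm (Fin (p + q))} {γ : Clan p q} (h : Compatible v γ)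
    {a b : Fin (p + q)} (hab : IsArc (min p q) v a b) (hl : b < a) :
    Compatible v (γ.conj (Equiv.swap a b)) where
  plus hpq x hx := by
    have h1 := hab.ne_of_isCore hx
    simpa [Clan.conj, Equiv.swap_apply_of_ne_of_ne h1.1 h1.2] using h.plus hpq x hx
  minus hpq x hx := by
    have h1 := hab.ne_of_isCore hx
    simpa [Clan.conj, Equiv.swap_apply_of_ne_of_ne h1.1 h1.2] using h.minus hpq x hx
  unmarked c d hcd hlt := by
    have h1 := IsArc.eq_iff (two_mul_min_le p q) hcd hab
    have hca : c ≠ a := by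
      rintro rfl
      obtain rfl := h1.1.1 rfl
      exact hl.not_gt hlt
    have hdb : d ≠ b := fun e => hca (h1.1.2 e)
    simp [Clan.conj, Equiv.swap_apply_of_ne_of_ne hca h1.2.1, h.unmarked c d hcd hlt,
      Equiv.swap_apply_of_ne_of_ne h1.2.2 hdb]
  marked c d hcd hlt := by
    have h1 := IsArc.eq_iff (two_mul_min_le p q) hcd hab
    by_cases hca : c = a
    · obtain rfl := hca
      obtain rfl := h1.1.1 rfl
      have := (oppFixed_conj (s := Equiv.swap c d)).2 (h.marked c d hcd hlt).symm
      simpa using this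
    · have hdb : d ≠ b := fun e => hca (h1.1.2 e)
      have := (oppFixed_conj (s := Equiv.swap a b)).2 (h.marked c d hcd hlt)
      rwa [Equiv.swap_apply_of_ne_of_ne hca h1.2.1,
        Equiv.swap_apply_of_ne_of_ne h1.2.2 hdb] at this

/-- A pair matched in `γ` must be an unmarked arc of `w`. For a marked arc, exchanging the signs of
`a` and `b` gives a second clan compatible with `v`, hence with `w`. As `a` changes sign it is not
in the core of `w`; its partner in `w` has the opposite sign in both clans, so it changes sign too
and must be `b`. -/
theorem isArc_of_compatible {v w : Equiv.Perm (Fin (p + q))} {γ : Clan p q} (hv : Compatible v γ)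
    (hvw : ∀ δ, Compatible v δ → Compatible w δ) {a b : Fin (p + q)}
    (hab : IsArc (min p q) v a b) : IsArc (min p q) w a b := by
  have hw := hvw γ hv
  have hne : a ≠ b := (IsArc.eq_iff (two_mul_min_le p q) hab hab).2.1
  rcases lt_or_gt_of_ne hne with hl | hl
  · have e := hv.unmarked a b hab hl
    rcases isCore_or_isArc (min p q) w a with hh | ⟨c, hc⟩ | ⟨c, hc⟩
    · exact absurd ((hw.matches.core a hh).symm.trans e) hne
    · rcases lt_or_gt_of_ne (IsArc.eq_iff (two_mul_min_le p q) hc hc).2.1 with h | h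
      · rwa [← e, (hw.matches.unmarked a c hc h).1]
      · exact absurd ((hw.matches.marked a c hc h).1.symm.trans e) hne
    · rcases lt_or_gt_of_ne (IsArc.eq_iff (two_mul_min_le p q) hc hc).2.1 with h | h
      · have := (hw.matches.unmarked c a hc h).2.symm.trans e
        exact absurd (this ▸ h) hl.not_gt
      · exact absurd ((hw.matches.marked c a hc h).2.symm.trans e) hne
  · have ho := hv.marked a b hab hl
    have e := (γ.oppFixed_fixed ho).1
    have hw' := hvw _ (hv.conj_marked hab hl)
    have hdisj : ∀ z, z ∈ γ.plus → z ∉ γ.minus := fun z h => Finset.disjoint_left.1 γ.disj h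
    have partner : ∀ c, c ≠ a → γ.OppFixed a c → (γ.conj (Equiv.swap a b)).OppFixed a c →
        c = b := by
      intro c hca h1 h2
      by_contra hcb
      have h3 : γ.OppFixed b c := by
        rw [← oppFixed_conj (s := Equiv.swap a b), Equiv.swap_apply_right,
          Equiv.swap_apply_of_ne_of_ne hca hcb]
        exact h2
      have d1 := hdisj a
      have d2 := hdisj b
      have d3 := hdisj c
      unfold OppFixed at ho h1 h3
      tauto
    rcases isCore_or_isArc (min p q) w a with hh | ⟨c, hc⟩ | ⟨c, hc⟩
    · exfalso
      have d1 := hdisj a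
      have d2 := hdisj b
      unfold OppFixed at ho
      rcases lt_trichotomy p q with h1 | h1 | h1
      · have h2 := hw.minus h1 a hh
        have h3 : b ∈ γ.minus := by simpa [Clan.conj] using hw'.minus h1 a hh
        tauto
      · unfold IsCore at hh
        omega
      · have h2 := hw.plus h1 a hh
        have h3 : b ∈ γ.plus := by simpa [Clan.conj] using hw'.plus h1 a hh
        tauto
    · have hca := (IsArc.eq_iff (two_mul_min_le p q) hc hc).2.1
      rcases lt_or_gt_of_ne hca with h | h
      · exact absurd ((hw.matches.unmarked a c hc h).1.symm.trans e) h.ne'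
      · rwa [← partner c hca.symm (hw.marked a c hc h) (hw'.marked a c hc h)]
    · have hca := (IsArc.eq_iff (two_mul_min_le p q) hc hc).2.1
      rcases lt_or_gt_of_ne hca with h | h
      · exact absurd ((hw.matches.unmarked c a hc h).2.symm.trans e) h.ne
      · have := partner c hca (hw.marked c a hc h).symm (hw'.marked c a hc h).symm
        exact absurd (this ▸ h) hl.not_gt

end Clan

/-! ### Unlabelled shapes as sets of directed arcs -/

theorem mem_shapeArcs {p q : ℕ} {w : Equiv.Perm (Fin (p + q))} {e : Sym2 (Fin (p + q))} :
    e ∈ shapeArcs p q w ↔ ∃ a b, IsArc (min p q) w a b ∧ e = s(a, b) := by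
  constructor
  · rintro ⟨c, hc, rfl⟩
    refine ⟨_, _, ⟨?_, ?_⟩, rfl⟩ <;> simp <;> omega
  · rintro ⟨a, b, hab, rfl⟩
    refine ⟨w a, hab.1, ?_⟩
    have : (w a).rev = w b := by
      ext
      have := hab.2
      rw [Fin.val_rev]
      omega
    simp [this]

theorem mem_shapeMarked {p q : ℕ} {w : Equiv.Perm (Fin (p + q))} {x : Fin (p + q)} :
    x ∈ shapeMarked p q w ↔ ∃ a b, IsArc (min p q) w a b ∧ b < a ∧ (x = a ∨ x = b) := by
  constructor
  · rintro ⟨c, hc, hl, hx⟩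
    refine ⟨_, _, ⟨?_, ?_⟩, hl, hx⟩ <;> simp <;> omega
  · rintro ⟨a, b, hab, hl, hx⟩
    have : (w a).rev = w b := by
      ext
      have := hab.2
      rw [Fin.val_rev]
      omega
    exact ⟨w a, hab.1, by simpa [this] using hl, by simpa [this] using hx⟩

/-- The arc set gives each arc up to direction; whether its ends are marked decides the direction.
-/
theorem isArc_of_unlabelledShape_eq {p q : ℕ} {v w : Equiv.Perm (Fin (p + q))}
    (h : unlabelledShape p q v = unlabelledShape p q w) {a b : Fin (p + q)}
    (hab : IsArc (min p q) v a b) : IsArc (min p q) w a b := by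
  have hm := Clan.two_mul_min_le p q
  obtain ⟨h1, h2⟩ := Prod.mk.inj h
  have h3 : s(a, b) ∈ shapeArcs p q w := h1 ▸ mem_shapeArcs.2 ⟨a, b, hab, rfl⟩
  obtain ⟨c, d, hcd, he⟩ := mem_shapeArcs.1 h3
  rcases Sym2.eq_iff.1 he with ⟨rfl, rfl⟩ | ⟨rfl, rfl⟩
  · exact hcd
  exfalso
  rcases lt_or_gt_of_ne (IsArc.eq_iff hm hab hab).2.1 with hl | hl
  · have h4 : a ∈ shapeMarked p q v := h2 ▸ mem_shapeMarked.2 ⟨b, a, hcd, hl, Or.inr rfl⟩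
    obtain ⟨e, f, hef, hlt, hx⟩ := mem_shapeMarked.1 h4
    have h5 := IsArc.eq_iff hm hab hef
    rcases hx with rfl | rfl
    · obtain rfl := h5.1.1 rfl
      exact hl.not_gt hlt
    · exact h5.2.1 rfl
  · have h4 : a ∈ shapeMarked p q w := h2 ▸ mem_shapeMarked.2 ⟨a, b, hab, hl, Or.inl rfl⟩
    obtain ⟨e, f, hef, hlt, hx⟩ := mem_shapeMarked.1 h4
    have h5 := IsArc.eq_iff hm hcd hef
    rcases hx with rfl | rfl
    · exact h5.2.2 rfl
    · obtain rfl := h5.1.2 rfl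
      exact hl.not_gt hlt

theorem unlabelledShape_eq_iff {p q : ℕ} {v w : Equiv.Perm (Fin (p + q))} :
    unlabelledShape p q v = unlabelledShape p q w ↔
      ∀ a b, IsArc (min p q) v a b ↔ IsArc (min p q) w a b := by
  constructor
  · exact fun h a b => ⟨isArc_of_unlabelledShape_eq h, isArc_of_unlabelledShape_eq h.symm⟩
  · intro h
    refine Prod.ext (Set.ext fun e => ?_) (Set.ext fun x => ?_)
    · change e ∈ shapeArcs p q v ↔ e ∈ shapeArcs p q w
      simp only [mem_shapeArcs, h]
    · change x ∈ shapeMarked p q v ↔ x ∈ shapeMarked p q w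
      simp only [mem_shapeMarked, h]

/-! ### Equivalence of atoms and the theorem -/

namespace ClanAtom

variable {p q : ℕ}

theorem isAdmissible (v : ClanAtom p q) : IsAdmissible (min p q) v.1 := by
  obtain ⟨γ, h⟩ := v.2
  exact (Clan.mem_atoms_iff.1 h).1

theorem equivalent_iff (v w : ClanAtom p q) :
    v.Equivalent w ↔ ∀ a b, IsArc (min p q) v.1 a b ↔ IsArc (min p q) w.1 a b := by
  constructor
  · intro h a b
    have hc : ∀ δ, Clan.Compatible v.1 δ ↔ Clan.Compatible w.1 δ := by
      intro δ
      have h1 : δ ∈ clansOf p q v.1 ↔ δ ∈ clansOf p q w.1 := by rw [h]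
      simpa [clansOf, Clan.mem_atoms_iff, v.isAdmissible, w.isAdmissible] using h1
    obtain ⟨γ, hγ⟩ := v.2
    have hγ' := (Clan.mem_atoms_iff.1 hγ).2
    exact ⟨Clan.isArc_of_compatible hγ' fun δ => (hc δ).1,
      Clan.isArc_of_compatible ((hc γ).1 hγ') fun δ => (hc δ).2⟩
  · intro h
    refine Set.ext fun δ => ?_
    simp only [clansOf, Set.mem_ofPred_eq, Clan.mem_atoms_iff, v.isAdmissible, w.isAdmissible,
      true_and]
    exact ⟨fun hc => hc.congr h, fun hc => hc.congr fun a b => (h a b).symm⟩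

theorem exists_exchange_mem_atoms {u : Equiv.Perm (Fin (p + q))} (hu : ∃ γ : Clan p q, u ∈ γ.atoms)
    {k : ℕ} (h1 : 1 ≤ k) (hk : k < min p q)
    (hl : permLength (adjSwap (p + q) k * adjSwap (p + q) (p + q - k) * u) = permLength u) :
    ∃ γ : Clan p q, adjSwap (p + q) k * adjSwap (p + q) (p + q - k) * u ∈ γ.atoms := by
  have hm := Clan.two_mul_min_le p q
  obtain ⟨γ, h⟩ := hu
  rw [Clan.mem_atoms_iff] at h
  exact ⟨γ, Clan.mem_atoms_iff.2 ⟨h.1.exchange_of_permLength_eq hm h1 hk hl,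
    h.2.congr fun a b => (isArc_exchange hm h1 hk u a b).symm⟩⟩

theorem Step.isArc_iff {v w : ClanAtom p q} (h : Step v w) (a b : Fin (p + q)) :
    IsArc (min p q) v.1 a b ↔ IsArc (min p q) w.1 a b := by
  obtain ⟨k, h1, hk, he, -⟩ := h
  rw [he, isArc_exchange (Clan.two_mul_min_le p q) h1 hk]

/-- Induction on the number of inversions of `w * v⁻¹`, which each suitable exchange in `v` lowers
by two. -/
theorem reflTransGen_step {v w : ClanAtom p q}
    (h : ∀ a b, IsArc (min p q) v.1 a b ↔ IsArc (min p q) w.1 a b) :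
    Relation.ReflTransGen Step v w := by
  have hm := Clan.two_mul_min_le p q
  induction hN : permLength (w.1 * v.1⁻¹) using Nat.strong_induction_on generalizing v with
  | _ N ih =>
    subst hN
    by_cases hne : w.1 * v.1⁻¹ = 1
    · rw [mul_inv_eq_one] at hne
      rw [Subtype.ext hne]
    · obtain ⟨k, h1, hk, hd⟩ := exists_opposite_labels v.isAdmissible w.isAdmissible h hne
      obtain ⟨x₀, x₁, z₀, z₁, hx, hz, hxk, hzk, e1, e2⟩ := exists_exchange hm h1 hk
      have hd := hd x₀ x₁ hx hxk
      have a1 : IsArc (min p q) v.1 (v.1⁻¹ x₀) (v.1⁻¹ z₁) := by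
        simp only [IsArc, perm_apply_inv]
        omega
      have a2 : IsArc (min p q) v.1 (v.1⁻¹ x₁) (v.1⁻¹ z₀) := by
        simp only [IsArc, perm_apply_inv]
        omega
      have hl : permLength (adjSwap (p + q) k * adjSwap (p + q) (p + q - k) * v.1) =
          permLength v.1 := by
        rw [e1, e2, permLength_exchange_iff hx hz (by omega)]
        -- The two arcs occur in opposite orders in `v` and `w`, so their order is not forced.
        refine v.isAdmissible.lt_iff_lt hm w.isAdmissible h a1 a2 ?_ hd
        rw [perm_apply_inv, perm_apply_inv, Fin.lt_def]
        omega
      let v' : ClanAtom p q := ⟨_, exists_exchange_mem_atoms v.2 h1 hk hl⟩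
      have hs : Step v v' := ⟨k, h1, hk, rfl, hl⟩
      refine Relation.ReflTransGen.head hs
        (ih _ ?_ (fun a b => (hs.isArc_iff a b).symm.trans (h a b)) rfl)
      -- The descent at the small labels has a mirror image at the large ends of the same arcs; the
      -- exchange removes both.
      have hd' : (w.1 * v.1⁻¹) z₁ < (w.1 * v.1⁻¹) z₀ := by
        have b1 := (h _ _).1 a1
        have b2 := (h _ _).1 a2
        unfold IsArc at b1 b2
        rw [Equiv.Perm.mul_apply, Equiv.Perm.mul_apply, Fin.lt_def]
        rw [Fin.lt_def] at hd
        omega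
      have l1 := permLength_mul_swap_of_gt _ hz hd'
      have l2 := permLength_mul_swap_of_gt (w.1 * v.1⁻¹ * Equiv.swap z₀ z₁) hx (by
        rw [Equiv.Perm.mul_apply _ (Equiv.swap z₀ z₁), Equiv.Perm.mul_apply _ (Equiv.swap z₀ z₁),
          Equiv.swap_apply_of_ne_of_ne, Equiv.swap_apply_of_ne_of_ne]
        · exact hd
        all_goals
          intro e
          subst e
          omega)
      have e3 : w.1 * v'.1⁻¹ = w.1 * v.1⁻¹ * Equiv.swap z₀ z₁ * Equiv.swap x₀ x₁ := by
        change w.1 * (adjSwap (p + q) k * adjSwap (p + q) (p + q - k) * v.1)⁻¹ = _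
        rw [e1, e2, mul_inv_rev, mul_inv_rev, Equiv.swap_inv, Equiv.swap_inv]
        simp only [mul_assoc]
      rw [e3]
      omega

end ClanAtom

theorem mainTheorem7 (p q : ℕ) :
    (∀ u : Equiv.Perm (Fin (p + q)), (∃ γ : Clan p q, u ∈ γ.atoms) →
      ∀ k : ℕ, 1 ≤ k → k < min p q →
        permLength (adjSwap (p + q) k * adjSwap (p + q) (p + q - k) * u) = permLength u →
        ∃ γ : Clan p q, adjSwap (p + q) k * adjSwap (p + q) (p + q - k) * u ∈ γ.atoms) ∧
    (∀ v w : ClanAtom p q, v.Equivalent w ↔ Relation.ReflTransGen ClanAtom.Step v w) ∧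
    (∀ v w : ClanAtom p q,
      v.Equivalent w ↔ unlabelledShape p q v.1 = unlabelledShape p q w.1) := by
  refine ⟨fun u hu k h1 hk hl => ClanAtom.exists_exchange_mem_atoms hu h1 hk hl,
    fun v w => ?_, fun v w => by rw [ClanAtom.equivalent_iff, unlabelledShape_eq_iff]⟩
  rw [ClanAtom.equivalent_iff]
  refine ⟨ClanAtom.reflTransGen_step, fun h => ?_⟩
  induction h with
  | refl => exact fun a b => Iff.rfl
  | tail _ hs ih => exact fun a b => (ih a b).trans (hs.isArc_iff a b)
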